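/- Let $\Sigma$ be a compact connected Riemann surface, $x$ a meromorphic function on $\Sigma$ whose differential $dx$ has finitely many zeros $c_1,\dots,c_n$, and $dy$ a meromorphic differential on $\Sigma$ (so $y$ may be a multivalued primitive). Let $B$ be a canonical bidifferential (Bergman kernel) on $\Sigma$: a symmetric bidifferential on $\Sigma\times\Sigma$, holomorphic off the diagonal and of the form $\frac{du\,dv}{(u-v)^2}+\text{holomorphic}$ near it, normalized so that $\oint_{p'\in\alpha_i}B(p,p')=0$ for given closed curves $\alpha_i$ and all $p\notin\alpha_i$ (in particular, for a choice of $A$-cycles $\alpha_i$). Put $$\eta(z)=d\Big(\frac{dy}{dx}(z)\Big)+\sum_{i=1}^n\operatorname*{Res}_{z'=c_i}\frac{dy}{dx}(z')\,B(z,z').$$ Assume one of the following: 1. $\Sigma$ is rational, $y$ is a global coordinate on $\Sigma$ (an isomorphism onto $\mathbb{P}^1$), and $x$ has a pole at the point $y=\infty$ (that is, $x(\infty)=\infty$); 2. the meromorphic function $\frac{dy}{dx}$ has poles only at zeros of $dx$; for example (this case is part of the claim), $dy$ is holomorphic on $\Sigma$. Then $\eta\equiv0$, that is, $\eta$ vanishes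 at every point of $\Sigma\setminus\{c_1,\dots,c_n\}$. Hence the compatibility condition holds: near each $c_i$, $\sigma^*\eta=\eta$ for every local involution $\sigma$ of $x$ at $c_i$ (a nontrivial holomorphic involution near $c_i$ that fixes $c_i$ and satisfies $x\circ\sigma=x$); and the Laplace transform $$\int \eta(w)\,e^{(x(w)-x(c_i))\zeta},\qquad \zeta>0,$$ along a curve through $c_i$ on which $x=x(c_i)-w^2/2$ with $w$ real, taken over all $w\in\mathbb{R}$ or over any symmetric open interval of $w$ on which the curve is defined, converges and equals $0$. -/

import Mathlib

open scoped Manifold ContDiff Topology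

noncomputable section

namespace SpectralCurve

variable {S : Type*} [TopologicalSpace S] [ChartedSpace ℂ S]

/-- The expression of a function `f` on `S` in the preferred holomorphic coordinate at `p`. -/
def localRep (f : S → ℂ) (p : S) : ℂ → ℂ :=
  fun u => f ((chartAt ℂ p).symm u)

/-- The order of vanishing at `p` of a meromorphic function on `S` (negative at a pole). -/
def ordAt (f : S → ℂ) (p : S) : WithTop ℤ :=
  meromorphicOrderAt (localRep f p) (chartAt ℂ p p)

/-- Meromorphic functions on `S`. The stored values are the true values away from the poles
(no spurious values at removable singularities); at a pole the stored value is `0`. -/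
def IsMeromorphicFun (f : S → ℂ) : Prop :=
  ∀ p, MeromorphicNFAt (localRep f p) (chartAt ℂ p p)

variable (S) in
/-- A (not necessarily continuous) field of complex covectors on `S`. A meromorphic differential is
such a field, with irrelevant values at the poles, that satisfies `OneForm.IsMeromorphic`. -/
abbrev OneForm : Type _ :=
  ∀ p : S, TangentSpace 𝓘(ℂ) p →L[ℂ] ℂ

/-- The exterior derivative `df` of a function `f`. -/
def d (f : S → ℂ) : OneForm S :=
  fun p => mfderiv 𝓘(ℂ) 𝓘(ℂ) f p

/-- The coordinate vector field `∂/∂u` of the preferred coordinate at `p`, at the point with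
coordinate `u`. -/
def coordVec (p : S) (u : ℂ) : TangentSpace 𝓘(ℂ) ((chartAt ℂ p).symm u) :=
  mfderiv 𝓘(ℂ) 𝓘(ℂ) (chartAt ℂ p).symm u (1 : ℂ)

namespace OneForm

/-- The function `h` with `θ = h(u) du` in the preferred coordinate `u` at `p`. -/
def coeff (θ : OneForm S) (p : S) : ℂ → ℂ :=
  fun u => θ ((chartAt ℂ p).symm u) (coordVec p u)

/-- `θ` is a meromorphic differential. -/
def IsMeromorphic (θ : OneForm S) : Prop :=
  ∀ p, MeromorphicAt (θ.coeff p) (chartAt ℂ p p)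

/-- The order of vanishing at `p` of a meromorphic differential (negative at a pole). -/
def ord (θ : OneForm S) (p : S) : WithTop ℤ :=
  meromorphicOrderAt (θ.coeff p) (chartAt ℂ p p)

/-- The residue of a meromorphic differential at `p`: the value of `(2πi)⁻¹ ∮ θ` over all
sufficiently small circles around `p`. -/
def residue (θ : OneForm S) (p : S) : ℂ :=
  Filter.limUnder (𝓝[>] (0 : ℝ)) fun r =>
    (2 * Real.pi * Complex.I)⁻¹ * ∮ u in C(chartAt ℂ p p, r), θ.coeff p u

/-- The meromorphic function `θ / τ`. At `p` it is the limit of the ratios of the values of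
`θ` and `τ` on a tangent vector at `q`, as `q` tends to `p`, so that removable singularities are
filled in. -/
def quotient (θ τ : OneForm S) : S → ℂ :=
  fun p => Filter.limUnder (𝓝[≠] p) fun q => θ q (1 : ℂ) / τ q (1 : ℂ)

end OneForm

variable (S) in
/-- A field of bilinear forms `T_p S × T_q S → ℂ` on `S × S`. -/
abbrev Bidifferential : Type _ :=
  ∀ p q : S, TangentSpace 𝓘(ℂ) p →L[ℂ] TangentSpace 𝓘(ℂ) q →L[ℂ] ℂ

namespace Bidifferential

/-- The function `b` with `B = b(u, v) du dv`, where `u` and `v` are the preferred coordinates at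
`p` and at `q`. -/
def coeff (B : Bidifferential S) (p q : S) : ℂ × ℂ → ℂ :=
  fun w => B ((chartAt ℂ p).symm w.1) ((chartAt ℂ q).symm w.2) (coordVec p w.1) (coordVec q w.2)

/-- Canonical bidifferentials (Bergman kernels): symmetric, holomorphic off the diagonal, and
of the form `du dv / (u - v)² + holomorphic` near the diagonal. -/
structure IsCanonical (B : Bidifferential S) : Prop where
  symm : ∀ p q, p ≠ q → ∀ (v : TangentSpace 𝓘(ℂ) p) (w : TangentSpace 𝓘(ℂ) q),
    B p q v w = B q p w v
  holomorphic_off_diag : ∀ p q, p ≠ q →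
    AnalyticAt ℂ (B.coeff p q) (chartAt ℂ p p, chartAt ℂ q q)
  double_pole : ∀ p, ∃ g : ℂ × ℂ → ℂ, AnalyticAt ℂ g (chartAt ℂ p p, chartAt ℂ p p) ∧
    ∀ᶠ w in 𝓝 (chartAt ℂ p p, chartAt ℂ p p), w.1 ≠ w.2 →
      B.coeff p p w = 1 / (w.1 - w.2) ^ 2 + g w

/-- For a fixed tangent vector `v` at `p`, the differential `p' ↦ B(p, p')` contracted with `v` in
the first slot. -/
def contract (B : Bidifferential S) (p : S) (v : TangentSpace 𝓘(ℂ) p) : OneForm S :=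
  fun q => B p q v

end Bidifferential

/-- The velocity `γ'(t)` of a curve in `S`. -/
def velocity (γ : ℝ → S) (t : ℝ) : TangentSpace 𝓘(ℂ) (γ t) :=
  mfderiv 𝓘(ℝ) 𝓘(ℝ, ℂ) γ t (1 : ℝ)

/-- Closed `C¹` curves in `S`, parametrized with period `1`. -/
def IsClosedCurve (γ : ℝ → S) : Prop :=
  ContMDiff 𝓘(ℝ) 𝓘(ℝ, ℂ) 1 γ ∧ Function.Periodic γ 1

/-- The normalization `∮_{p' ∈ γ} B(p, p') = 0` for all `p` off the curve `γ`. -/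
def Bidifferential.IsNormalizedOn (B : Bidifferential S) (γ : ℝ → S) : Prop :=
  ∀ p, p ∉ Set.range γ → ∀ v : TangentSpace 𝓘(ℂ) p,
    ∫ t in (0 : ℝ)..1, B.contract p v (γ t) (velocity γ t) = 0

/-- `z` is a global coordinate on a rational curve, with `z = ∞` exactly at the point `q`:
a holomorphic bijection from the complement of `q` to `ℂ`, with a simple pole at `q`. -/
structure IsGlobalCoordinate (z : S → ℂ) (q : S) : Prop where
  holomorphic : ∀ p, p ≠ q → MDifferentiableAt 𝓘(ℂ) 𝓘(ℂ) z p
  bijOn : Set.BijOn z {q}ᶜ Set.univ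
  simple_pole : ordAt z q = -1

/-- The differential
`η(z) = d(dy/dx)(z) + ∑ i, Res_{z' = c i} (dy/dx)(z') B(z, z')`,
evaluated on a tangent vector `v` at `z`. -/
def eta (x : S → ℂ) (dy : OneForm S) (B : Bidifferential S) {n : ℕ} (c : Fin n → S)
    (z : S) (v : TangentSpace 𝓘(ℂ) z) : ℂ :=
  d (dy.quotient (d x)) z v +
    ∑ i, OneForm.residue (fun z' => dy.quotient (d x) z' • B.contract z v z') (c i)

/-- `σ` is (a representative of the germ of) the local involution defined by `x` near the point
`a`: a nontrivial holomorphic involution near `a` that fixes `a` and satisfies `x ∘ σ = x`. -/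
structure IsLocalInvolution (x : S → ℂ) (a : S) (σ : S → S) : Prop where
  fixed : σ a = a
  holomorphic : ∀ᶠ p in 𝓝 a, MDifferentiableAt 𝓘(ℂ) 𝓘(ℂ) σ p
  involutive : ∀ᶠ p in 𝓝 a, σ (σ p) = p
  preserves : ∀ᶠ p in 𝓝 a, x (σ p) = x p
  nontrivial : ¬ ∀ᶠ p in 𝓝 a, σ p = p

/-- `η` is invariant near `a` under every local involution of `x` at `a`: `σ^* η = η` on a punctured
neighbourhood of `a`. -/
def InvariantAt (x : S → ℂ) (a : S) (η : ∀ p : S, TangentSpace 𝓘(ℂ) p → ℂ) : Prop :=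
  ∀ σ : S → S, IsLocalInvolution x a σ →
    ∀ᶠ p in 𝓝[≠] a, ∀ v : TangentSpace 𝓘(ℂ) p,
      η (σ p) (mfderiv 𝓘(ℂ) 𝓘(ℂ) σ p v) = η p v

/-- The vanishing of the Laplace transform `∫ η(w) exp((x(w) - x(a)) ζ)`. The integral is taken
along the curves through `a` on which `x = x(a) - w² / 2` with `w` real; `w` runs over the whole
line if such a curve exists, and in general over the symmetric open intervals on which it is
defined. -/
def LaplaceVanishesAt (x : S → ℂ) (a : S) (η : ∀ p : S, TangentSpace 𝓘(ℂ) p → ℂ) : Prop :=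
  ∀ (I : Set ℝ) (γ : ℝ → S), IsOpen I → I.OrdConnected → 0 ∈ I → (∀ w ∈ I, -w ∈ I) →
    ContMDiffOn 𝓘(ℝ) 𝓘(ℝ, ℂ) 1 γ I → γ 0 = a →
    (∀ w ∈ I, x (γ w) = x a - (w : ℂ) ^ 2 / 2) →
    ∀ ζ : ℝ, 0 < ζ →
      MeasureTheory.IntegrableOn
        (fun w : ℝ => η (γ w) (velocity γ w) * Complex.exp ((x (γ w) - x a) * ζ)) I ∧
      ∫ w in I, η (γ w) (velocity γ w) * Complex.exp ((x (γ w) - x a) * ζ) = 0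

end SpectralCurve

end

open SpectralCurve

/-!
The differential `η(z) = d(dy/dx)(z) + ∑ Res_{z' = c i} (dy/dx)(z') B(z, z')` vanishes by the residue
theorem. Fix `z` off the zeros `c i` of `dx` and a tangent vector at `z`, and put `f = dy/dx`. In
each of the three cases `f` is holomorphic off the `c i`: outside the zeros of `dx` the order of `dx`
is at most `0`, so `f` has no pole where `dy` has none, and at the pole of a global coordinate `y`
the double pole of `dy` is compensated by that of `dx`
(`ordAt_quotient_nonneg_of_isGlobalCoordinate`). So the differential `z' ↦ f(z') B(z, z')` is
holomorphic off the `c i` and `z`. At `z` the double pole of `B` makes its residue `df(z)`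
(`residue_smul_contract`), so `η(z)` is the sum of all its residues, which is `0`.

The residue theorem on a compact Riemann surface (`sum_residue_eq_zero`) is proved for differentials
`θ` with isolated singularities, by pairing `θ` with functions. For smooth functions `g` and `φ`, the
expression `g · 2∂φ/∂ū · θ` is a `(1,1)`-form, so its integral over a chart domain does not depend on
the coordinate (`chartIntegral_eq`). If `φ` is supported in one chart domain and is `1` near the
only singularity in its support, then Stokes' theorem and polar coordinates identify the pairing
with `g = 1` as a multiple of the residue (`residue_eq_chartIntegral`). For a partition of unity
`ρ p` whose members are constant near the singularities, the sum of these pairings is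
`∑ p, ∑ r, ∫ ρ r · 2∂(ρ p)/∂ū · θ`. Summed over `p` first it is `0`, since `∑ p, ρ p` is constant.

Given the vanishing off the `c i`, the invariance holds since a local involution maps a
punctured neighbourhood of `c i` to points other than the `c i`, and the Laplace integrand vanishes
outside a finite set since `x = x(a) - w² / 2` takes each value for at most two `w`.
-/

namespace SpectralCurve

open Complex MeasureTheory Set Filter Metric

/-! ### The Cauchy–Riemann operator in the plane -/

/-- The Cauchy–Riemann operator `2 ∂/∂ū = ∂/∂x + i ∂/∂y`. -/
noncomputable def dbar (φ : ℂ → ℂ) (u : ℂ) : ℂ :=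
  fderiv ℝ φ u 1 + I * fderiv ℝ φ u I

lemma dbar_congr {φ ψ : ℂ → ℂ} {u : ℂ} (h : φ =ᶠ[𝓝 u] ψ) : dbar φ u = dbar ψ u := by
  simp only [dbar, h.fderiv_eq]

lemma dbar_const (a u : ℂ) : dbar (fun _ => a) u = 0 := by
  simp [dbar]

lemma continuous_dbar {φ : ℂ → ℂ} (hφ : ContDiff ℝ 1 φ) : Continuous (dbar φ) := by
  have h := hφ.continuous_fderiv one_ne_zero
  unfold dbar
  fun_prop

lemma dbar_eq_zero_of_notMem_tsupport {φ : ℂ → ℂ} {u : ℂ} (hu : u ∉ tsupport φ) :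
    dbar φ u = 0 := by
  rw [dbar_congr (notMem_tsupport_iff_eventuallyEq.mp hu)]
  exact dbar_const 0 u

lemma tsupport_dbar_subset (φ : ℂ → ℂ) : tsupport (dbar φ) ⊆ tsupport φ :=
  closure_minimal (fun u hu => by
    by_contra h
    exact hu (dbar_eq_zero_of_notMem_tsupport h)) (isClosed_tsupport φ)

lemma notMem_tsupport_dbar {φ : ℂ → ℂ} {u a : ℂ} (h : ∀ᶠ v in 𝓝 u, φ v = a) :
    u ∉ tsupport (dbar φ) := by
  rw [notMem_tsupport_iff_eventuallyEq]
  filter_upwards [h.eventually_nhds] with v hv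
  rw [dbar_congr (ψ := fun _ => a) hv, dbar_const]
  rfl

lemma dbar_sub {φ ψ : ℂ → ℂ} {u : ℂ} (hφ : DifferentiableAt ℝ φ u)
    (hψ : DifferentiableAt ℝ ψ u) :
    dbar (fun v => φ v - ψ v) u = dbar φ u - dbar ψ u := by
  simp only [dbar, fderiv_fun_sub hφ hψ, sub_apply]
  ring

lemma dbar_sum {ι : Type*} (s : Finset ι) {φ : ι → ℂ → ℂ} {u : ℂ}
    (hφ : ∀ i ∈ s, DifferentiableAt ℝ (φ i) u) :
    dbar (fun v => ∑ i ∈ s, φ i v) u = ∑ i ∈ s, dbar (φ i) u := by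
  simp only [dbar, fderiv_fun_sum hφ, sum_apply, Finset.mul_sum,
    Finset.sum_add_distrib]

/-- A holomorphic factor passes through the Cauchy–Riemann operator. -/
lemma dbar_mul {φ h : ℂ → ℂ} {u : ℂ} (hφ : DifferentiableAt ℝ φ u)
    (hh : DifferentiableAt ℂ h u) :
    dbar (fun v => φ v * h v) u = dbar φ u * h u := by
  have h1 : HasFDerivAt h ((fderiv ℂ h u).restrictScalars ℝ) u :=
    hh.hasFDerivAt.restrictScalars ℝ
  have h2 := hφ.hasFDerivAt.mul h1
  have h3 : fderiv ℂ h u I = I * deriv h u := by simp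
  simp only [dbar]
  rw [show (fun v => φ v * h v) = φ * h from rfl, h2.fderiv]
  simp [h3]
  linear_combination (φ u * deriv h u) * I_mul_I

/-- The chain rule for a holomorphic change of variable. -/
lemma dbar_comp {φ ψ : ℂ → ℂ} {u : ℂ} (hφ : DifferentiableAt ℝ φ (ψ u))
    (hψ : DifferentiableAt ℂ ψ u) :
    dbar (fun v => φ (ψ v)) u = dbar φ (ψ u) * (starRingEnd ℂ) (deriv ψ u) := by
  have h1 : HasFDerivAt ψ ((fderiv ℂ ψ u).restrictScalars ℝ) u :=
    hψ.hasFDerivAt.restrictScalars ℝ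
  have h2 := hφ.hasFDerivAt.comp u h1
  have h3 : fderiv ℂ ψ u I = I * deriv ψ u := by simp
  have h4 (z : ℂ) : fderiv ℝ φ (ψ u) z = z.re * fderiv ℝ φ (ψ u) 1 +
      z.im * fderiv ℝ φ (ψ u) I := by
    have : z = z.re • (1 : ℂ) + z.im • I := by simp
    conv_lhs => rw [this]
    rw [map_add, map_smul, map_smul, real_smul, real_smul]
  simp only [dbar]
  rw [show (fun v => φ (ψ v)) = φ ∘ ψ from rfl, h2.fderiv]
  simp only [ContinuousLinearMap.comp_apply, ContinuousLinearMap.coe_restrictScalars', h3,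
    fderiv_apply_one_eq_deriv]
  rw [h4 (deriv ψ u), h4 (I * deriv ψ u)]
  have h5 : (starRingEnd ℂ) (deriv ψ u) = (deriv ψ u).re - (deriv ψ u).im * I := by
    apply Complex.ext <;> simp
  rw [h5]
  simp
  linear_combination (fderiv ℝ φ (ψ u) I * (deriv ψ u).im) * I_mul_I

lemma continuous_mul_of_tsupport {k h : ℂ → ℂ} (hk : Continuous k)
    (hh : ∀ u ∈ tsupport k, ContinuousAt h u) : Continuous (fun u => k u * h u) := by
  rw [continuous_iff_continuousAt]
  intro u
  by_cases hu : u ∈ tsupport k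
  · exact hk.continuousAt.mul (hh u hu)
  · have : (fun v => k v * h v) =ᶠ[𝓝 u] fun _ => 0 := by
      filter_upwards [notMem_tsupport_iff_eventuallyEq.mp hu] with v hv
      simp [hv]
    exact continuousAt_const.congr this.symm

lemma integrable_mul_of_tsupport {k h : ℂ → ℂ} (hk : Continuous k) (hc : HasCompactSupport k)
    (hh : ∀ u ∈ tsupport k, ContinuousAt h u) : Integrable (fun u => k u * h u) :=
  (continuous_mul_of_tsupport hk hh).integrable_of_hasCompactSupport hc.mul_right

/-- Stokes' theorem in the plane for compactly supported functions. -/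
lemma integral_dbar_eq_zero {g : ℂ → ℂ} (hg : ContDiff ℝ 1 g) (hc : HasCompactSupport g) :
    ∫ u, dbar g u = 0 := by
  have hcont := hg.continuous_fderiv one_ne_zero
  have hint (v : ℂ) : Integrable (fun u => fderiv ℝ g u v) :=
    (hcont.clm_apply continuous_const).integrable_of_hasCompactSupport (hc.fderiv_apply ℝ v)
  have key (v : ℂ) : ∫ u, fderiv ℝ g u v = 0 := by
    have := integral_mul_fderiv_eq_neg_fderiv_mul_of_integrable (μ := (volume : Measure ℂ))
      (f := fun _ : ℂ => (1 : ℂ)) (g := g) (v := v) (by simp) (by simpa using hint v)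
      (by simpa using hg.continuous.integrable_of_hasCompactSupport hc)
      (fun _ _ => differentiableAt_const _)
      (fun u _ => (hg.differentiable one_ne_zero) u)
    simpa using this
  simp only [dbar]
  rw [integral_add (hint 1) ((hint I).const_mul I), integral_const_mul, key, key]
  simp

lemma integral_dbar_mul_eq_zero {φ h : ℂ → ℂ} (hφ : ContDiff ℝ 1 φ) (hc : HasCompactSupport φ)
    (hh : ∀ u ∈ tsupport φ, AnalyticAt ℂ h u) : ∫ u, dbar φ u * h u = 0 := by
  have hg : ContDiff ℝ 1 (fun u => φ u * h u) := by
    rw [contDiff_iff_contDiffAt]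
    intro u
    by_cases hu : u ∈ tsupport φ
    · exact hφ.contDiffAt.mul ((hh u hu).contDiffAt.restrict_scalars ℝ)
    · refine (contDiffAt_const (c := (0 : ℂ))).congr_of_eventuallyEq ?_
      filter_upwards [notMem_tsupport_iff_eventuallyEq.mp hu] with v hv
      simp [hv]
  rw [← integral_dbar_eq_zero hg hc.mul_right]
  congr 1 with u
  by_cases hu : u ∈ tsupport φ
  · exact (dbar_mul (hφ.differentiable one_ne_zero u) (hh u hu).differentiableAt).symm
  · rw [dbar_eq_zero_of_notMem_tsupport hu, dbar_congr (ψ := fun _ => 0), dbar_const, zero_mul]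
    filter_upwards [notMem_tsupport_iff_eventuallyEq.mp hu] with v hv
    simp [hv]

/-- Only the behaviour of a cut-off function near an isolated singularity matters. -/
lemma integral_dbar_mul_congr {φ₁ φ₂ h : ℂ → ℂ} {u₀ : ℂ} (h₁ : ContDiff ℝ 1 φ₁)
    (h₂ : ContDiff ℝ 1 φ₂) (hc₁ : HasCompactSupport φ₁) (hc₂ : HasCompactSupport φ₂)
    (ho₁ : ∀ᶠ u in 𝓝 u₀, φ₁ u = 1) (ho₂ : ∀ᶠ u in 𝓝 u₀, φ₂ u = 1)
    (hh₁ : ∀ u ∈ tsupport φ₁, u ≠ u₀ → AnalyticAt ℂ h u)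
    (hh₂ : ∀ u ∈ tsupport φ₂, u ≠ u₀ → AnalyticAt ℂ h u) :
    ∫ u, dbar φ₁ u * h u = ∫ u, dbar φ₂ u * h u := by
  have aux {φ : ℂ → ℂ} (hφ : ContDiff ℝ 1 φ) (hc : HasCompactSupport φ)
      (ho : ∀ᶠ u in 𝓝 u₀, φ u = 1) (hh : ∀ u ∈ tsupport φ, u ≠ u₀ → AnalyticAt ℂ h u) :
      Integrable (fun u => dbar φ u * h u) := by
    refine integrable_mul_of_tsupport (continuous_dbar hφ)
      (hc.mono' ((subset_tsupport _).trans (tsupport_dbar_subset φ))) fun u hu => ?_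
    refine (hh u (tsupport_dbar_subset φ hu) ?_).continuousAt
    rintro rfl
    exact notMem_tsupport_dbar ho hu
  rw [← sub_eq_zero, ← integral_sub (aux h₁ hc₁ ho₁ hh₁) (aux h₂ hc₂ ho₂ hh₂)]
  have hz := integral_dbar_mul_eq_zero (φ := fun u => φ₁ u - φ₂ u) (h := h) (h₁.sub h₂)
    (hc₁.sub hc₂) (fun u hu => ?_)
  · rw [← hz]
    congr 1 with u
    rw [dbar_sub (h₁.differentiable one_ne_zero u) (h₂.differentiable one_ne_zero u)]
    ring
  · have hne : u ≠ u₀ := by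
      rintro rfl
      refine (notMem_tsupport_iff_eventuallyEq.mpr ?_) hu
      filter_upwards [ho₁, ho₂] with v hv₁ hv₂
      simp [hv₁, hv₂]
    rcases (tsupport_sub φ₁ φ₂) hu with hu | hu
    · exact hh₁ u hu hne
    · exact hh₂ u hu hne

/-! ### Circle integrals as area integrals against a cut-off function -/

lemma circleIntegral_eq_integral_Ioo (h : ℂ → ℂ) (u₀ : ℂ) (r : ℝ) :
    ∮ u in C(u₀, r), h u = ∫ θ in Ioo (-Real.pi) Real.pi,
      I * (circleMap 0 r θ * h (circleMap u₀ r θ)) := by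
  have hper : Function.Periodic (fun θ : ℝ => I * (circleMap 0 r θ * h (circleMap u₀ r θ)))
      (2 * Real.pi) := fun θ => by
    simp only [periodic_circleMap _ _ θ]
  have h1 := hper.intervalIntegral_add_eq 0 (-Real.pi)
  have h2 : -Real.pi + 2 * Real.pi = Real.pi := by ring
  rw [zero_add, h2] at h1
  rw [← integral_Ioc_eq_integral_Ioo,
    ← intervalIntegral.integral_of_le (by linarith [Real.pi_pos]), ← h1, circleIntegral]
  congr 1 with θ
  simp only [deriv_circleMap, smul_eq_mul]
  ring

/-- A radial cut-off function turns the circle integral into an area integral, by integration in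
polar coordinates. -/
lemma exists_integral_dbar_mul_eq_circleIntegral {h : ℂ → ℂ} {u₀ : ℂ} {R : ℝ} (hR : 0 < R)
    (hh : ∀ u ∈ closedBall u₀ R, u ≠ u₀ → AnalyticAt ℂ h u) :
    ∃ φ : ℂ → ℂ, ContDiff ℝ 1 φ ∧ HasCompactSupport φ ∧ (∀ᶠ u in 𝓝 u₀, φ u = 1) ∧
      tsupport φ ⊆ closedBall u₀ R ∧
      ∫ u, dbar φ u * h u = I * ∮ u in C(u₀, R), h u := by
  -- `β` is `1` up to `R ^ 2 / 2` and `0` from `3 * R ^ 2 / 4` on.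
  set β : ℝ → ℝ := fun t => Real.smoothTransition (3 - 4 * t / R ^ 2) with hβ
  have hβs : ContDiff ℝ 1 β := Real.smoothTransition.contDiff.comp (by fun_prop)
  have hR2 : 0 < R ^ 2 := by positivity
  have hβ1 (t : ℝ) (ht : t ≤ R ^ 2 / 2) : β t = 1 := by
    apply Real.smoothTransition.one_of_one_le
    have : 4 * t / R ^ 2 ≤ 2 := by rw [div_le_iff₀ hR2]; linarith
    linarith
  have hβ0 (t : ℝ) (ht : 3 * R ^ 2 / 4 ≤ t) : β t = 0 := by
    apply Real.smoothTransition.zero_of_nonpos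
    have : 3 ≤ 4 * t / R ^ 2 := by rw [le_div_iff₀ hR2]; linarith
    linarith
  have hβd0 (t : ℝ) (ht : R ^ 2 ≤ t) : deriv β t = 0 := by
    have : β =ᶠ[𝓝 t] fun _ => 0 := by
      filter_upwards [lt_mem_nhds (show 3 * R ^ 2 / 4 < t by linarith)] with s hs
      exact hβ0 s hs.le
    rw [this.deriv_eq, deriv_const]
  set φ : ℂ → ℂ := fun u => (β (‖u - u₀‖ ^ 2) : ℂ) with hφ
  have hn : ContDiff ℝ 1 (fun u : ℂ => ‖u - u₀‖ ^ 2) := (contDiff_id.sub contDiff_const).norm_sq ℝ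
  have hφs : ContDiff ℝ 1 φ := ofRealCLM.contDiff.comp (hβs.comp hn)
  have hsupp : tsupport φ ⊆ closedBall u₀ R := by
    refine closure_minimal (fun u hu => ?_) isClosed_closedBall
    by_contra hlt
    rw [mem_closedBall, dist_eq_norm, not_le] at hlt
    apply hu
    simp only [hφ]
    rw [hβ0 _ (by nlinarith), ofReal_zero]
  have hone : ∀ᶠ u in 𝓝 u₀, φ u = 1 := by
    have : ∀ᶠ u in 𝓝 u₀, ‖u - u₀‖ ^ 2 < R ^ 2 / 2 :=
      hn.continuous.continuousAt.eventually_lt continuousAt_const (by simpa using hR2)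
    filter_upwards [this] with u hu
    simp only [hφ]
    rw [hβ1 _ hu.le, ofReal_one]
  have hcs : HasCompactSupport φ := (isCompact_closedBall u₀ R).of_isClosed_subset
    (isClosed_tsupport φ) hsupp
  have hdbar (u : ℂ) : dbar φ u = 2 * ((deriv β (‖u - u₀‖ ^ 2) : ℝ) : ℂ) * (u - u₀) := by
    have h1 : HasFDerivAt (fun u : ℂ => ‖u - u₀‖ ^ 2) _ u :=
      ((hasFDerivAt_id (𝕜 := ℝ) u).sub_const u₀).norm_sq
    have h2 := (hβs.differentiable one_ne_zero (‖u - u₀‖ ^ 2)).hasDerivAt.comp_hasFDerivAt u h1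
    have h3 : HasFDerivAt φ _ u := ofRealCLM.hasFDerivAt.comp u h2
    rw [dbar, h3.fderiv]
    simp
    apply Complex.ext <;> simp <;> ring
  refine ⟨φ, hφs, hcs, hone, hsupp, ?_⟩
  set G : ℂ → ℂ := fun w => dbar φ (u₀ + w) * h (u₀ + w) with hG
  have hGc : Continuous G := by
    refine (continuous_mul_of_tsupport (continuous_dbar hφs) fun u hu => ?_).comp
      (continuous_const.add continuous_id)
    refine (hh u (hsupp (tsupport_dbar_subset φ hu)) ?_).continuousAt
    rintro rfl
    exact notMem_tsupport_dbar hone hu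
  have hpol (p : ℝ × ℝ) : Complex.polarCoord.symm p = circleMap 0 p.1 p.2 := by
    rw [Complex.polarCoord_symm_apply, circleMap_zero, exp_mul_I, ofReal_cos, ofReal_sin]
  have hconst (r : ℝ) (hr : 0 < r) (hrR : r ≤ R) :
      ∮ u in C(u₀, r), h u = ∮ u in C(u₀, R), h u := by
    have hne (u : ℂ) (hu : u ∈ closedBall u₀ R \ ball u₀ r) : AnalyticAt ℂ h u := by
      refine hh u hu.1 ?_
      rintro rfl
      exact hu.2 (mem_ball_self hr)
    refine (circleIntegral_eq_of_differentiable_on_annulus_off_countable hr hrR countable_empty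
      (fun u hu => (hne u hu).continuousAt.continuousWithinAt) fun u hu => ?_).symm
    exact (hne u ⟨ball_subset_closedBall hu.1.1, fun h' =>
      hu.1.2 (ball_subset_closedBall h')⟩).differentiableAt
  have hFc : Continuous (fun p : ℝ × ℝ => p.1 • G (circleMap 0 p.1 p.2)) := by
    refine continuous_fst.smul (hGc.comp ?_)
    simp only [circleMap]
    fun_prop
  have hG0 (r θ : ℝ) (hr : R ≤ r) : G (circleMap 0 r θ) = 0 := by
    have : ‖circleMap 0 r θ‖ = r := by simp [abs_of_pos (hR.trans_le hr)]
    simp only [hG, hdbar, add_sub_cancel_left, this]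
    rw [hβd0 _ (by nlinarith)]
    simp
  have hint : IntegrableOn (fun p : ℝ × ℝ => p.1 • G (circleMap 0 p.1 p.2))
      (Ioi 0 ×ˢ Ioo (-Real.pi) Real.pi) := by
    have hK : IsCompact (Icc 0 R ×ˢ Icc (-Real.pi) Real.pi) := isCompact_Icc.prod isCompact_Icc
    refine (hFc.continuousOn.integrableOn_compact hK).of_forall_sdiff_eq_zero
      (measurableSet_Ioi.prod measurableSet_Ioo) ?_
    rintro ⟨r, θ⟩ ⟨⟨hr, hθ⟩, hn⟩
    have : R ≤ r := by
      by_contra hlt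
      exact hn ⟨⟨le_of_lt hr, (not_le.mp hlt).le⟩, Ioo_subset_Icc_self hθ⟩
    simp [hG0 r θ this]
  have hinner (r : ℝ) (hr : r ∈ Ioi (0 : ℝ)) :
      ∫ θ in Ioo (-Real.pi) Real.pi, r • G (circleMap 0 r θ) =
        ((deriv (fun s => β (s ^ 2)) r : ℝ) : ℂ) * (-I * ∮ u in C(u₀, R), h u) := by
    have hd : deriv (fun s => β (s ^ 2)) r = deriv β (r ^ 2) * (2 * r) := by
      have := (hβs.differentiable one_ne_zero (r ^ 2)).hasDerivAt.comp r (hasDerivAt_pow 2 r)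
      simpa [Function.comp_def] using this.deriv
    rcases le_or_gt R r with hRr | hRr
    · simp only [hG0 r _ hRr, hd, hβd0 _ (show R ^ 2 ≤ r ^ 2 by nlinarith)]
      simp
    · rw [← hconst r hr hRr.le, circleIntegral_eq_integral_Ioo, ← integral_const_mul,
        ← integral_const_mul]
      refine setIntegral_congr_fun measurableSet_Ioo fun θ _ => ?_
      have hnr : ‖circleMap 0 r θ‖ = r := by simp [abs_of_pos (show 0 < r from hr)]
      have hc : circleMap u₀ r θ = u₀ + circleMap 0 r θ := by simp [circleMap]
      simp only [hG, hdbar, add_sub_cancel_left, hnr, hd, hc, real_smul]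
      push_cast
      linear_combination (2 * r * (deriv β (r ^ 2) : ℝ) * circleMap 0 r θ *
        h (u₀ + circleMap 0 r θ)) * I_mul_I
  -- Circle integrals are constant in `r`, so only the total increment of `β` enters.
  have hrad : ∫ r in Ioi (0 : ℝ), deriv (fun s => β (s ^ 2)) r = -1 := by
    have hc : HasCompactSupport (fun s => β (s ^ 2)) := by
      refine HasCompactSupport.of_support_subset_isCompact (isCompact_closedBall (0 : ℝ) R)
        fun s hs => ?_
      rw [mem_closedBall_zero_iff, Real.norm_eq_abs]
      by_contra hlt
      refine hs (hβ0 _ ?_)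
      rw [← sq_abs s]
      nlinarith
    have := hc.integral_Ioi_deriv_eq (hβs.comp (contDiff_id.pow 2)) 0
    simpa [Function.comp_def, hβ1 0 (by positivity)] using this
  calc ∫ u, dbar φ u * h u = ∫ w, G w := (integral_add_left_eq_self _ u₀).symm
    _ = ∫ p in Ioi 0 ×ˢ Ioo (-Real.pi) Real.pi, p.1 • G (circleMap 0 p.1 p.2) := by
      rw [← Complex.integral_comp_polarCoord_symm, polarCoord_target]
      simp only [hpol]
    _ = ∫ r in Ioi (0 : ℝ), ∫ θ in Ioo (-Real.pi) Real.pi, r • G (circleMap 0 r θ) :=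
      setIntegral_prod _ hint
    _ = ∫ r in Ioi (0 : ℝ), ((deriv (fun s => β (s ^ 2)) r : ℝ) : ℂ) *
          (-I * ∮ u in C(u₀, R), h u) := setIntegral_congr_fun measurableSet_Ioi hinner
    _ = I * ∮ u in C(u₀, R), h u := by
      rw [integral_mul_const, integral_complex_ofReal, hrad]
      push_cast
      ring

/-- For any cut-off function `φ` that is `1` near an isolated singularity `u₀` of `h`, the area
integral of `2 ∂φ/∂ū` against `h` is `i` times the integral of `h` over small circles. -/
lemma eventually_integral_dbar_mul_eq_circleIntegral {φ h : ℂ → ℂ} {u₀ : ℂ}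
    (hφ : ContDiff ℝ 1 φ) (hc : HasCompactSupport φ) (ho : ∀ᶠ u in 𝓝 u₀, φ u = 1)
    (hh : ∀ u ∈ tsupport φ, u ≠ u₀ → AnalyticAt ℂ h u) :
    ∀ᶠ r in 𝓝[>] (0 : ℝ), ∫ u, dbar φ u * h u = I * ∮ u in C(u₀, r), h u := by
  obtain ⟨R, hR, hball⟩ := nhds_basis_closedBall.eventually_iff.mp ho
  have hsub : closedBall u₀ R ⊆ tsupport φ := fun u hu =>
    subset_tsupport φ (by simp [hball hu])
  filter_upwards [Ioo_mem_nhdsGT hR] with r hr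
  have hr' : closedBall u₀ r ⊆ closedBall u₀ R := closedBall_subset_closedBall hr.2.le
  obtain ⟨φ', h1, h2, h3, h4, h5⟩ := exists_integral_dbar_mul_eq_circleIntegral (h := h) hr.1
    fun u hu => hh u (hsub (hr' hu))
  rw [← h5]
  exact integral_dbar_mul_congr hφ h1 hc h2 ho h3 hh fun u hu => hh u (hsub (hr' (h4 hu)))

variable {S : Type*} [TopologicalSpace S] [ChartedSpace ℂ S]

/-! ### Coordinate changes -/

/-- The change of coordinates from the preferred coordinate at `p` to the one at `q`. -/
noncomputable def transition (p q : S) (u : ℂ) : ℂ :=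
  chartAt ℂ q ((chartAt ℂ p).symm u)

lemma eventually_mem_target {p : S} {u : ℂ} (hu : u ∈ (chartAt ℂ p).target) :
    ∀ᶠ v in 𝓝 u, v ∈ (chartAt ℂ p).target :=
  (chartAt ℂ p).open_target.mem_nhds hu

lemma eventually_symm_mem_source {p q : S} {u : ℂ} (hu : u ∈ (chartAt ℂ p).target)
    (hq : (chartAt ℂ p).symm u ∈ (chartAt ℂ q).source) :
    ∀ᶠ v in 𝓝 u, (chartAt ℂ p).symm v ∈ (chartAt ℂ q).source :=
  ((chartAt ℂ p).symm.continuousAt hu).eventually ((chartAt ℂ q).open_source.mem_nhds hq)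

lemma chartAt_symm_transition {p q : S} {u : ℂ}
    (hq : (chartAt ℂ p).symm u ∈ (chartAt ℂ q).source) :
    (chartAt ℂ q).symm (transition p q u) = (chartAt ℂ p).symm u :=
  (chartAt ℂ q).left_inv hq

lemma deriv_transition_self {p : S} {u : ℂ} (hu : u ∈ (chartAt ℂ p).target) :
    deriv (transition p p) u = 1 := by
  have : transition p p =ᶠ[𝓝 u] id := by
    filter_upwards [eventually_mem_target hu] with v hv
    exact (chartAt ℂ p).right_inv hv
  rw [this.deriv_eq, deriv_id]

section Holomorphic

variable [IsManifold 𝓘(ℂ) ω S]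

lemma isManifold_one_of_omega : IsManifold 𝓘(ℂ) 1 S := IsManifold.of_le (n := ω) le_top

lemma analyticAt_transition {p q : S} {u : ℂ} (hu : u ∈ (chartAt ℂ p).target)
    (hq : (chartAt ℂ p).symm u ∈ (chartAt ℂ q).source) :
    AnalyticAt ℂ (transition p q) u := by
  have h1 : ContMDiffAt 𝓘(ℂ) 𝓘(ℂ) ω (chartAt ℂ p).symm u :=
    (contMDiffOn_chart_symm (I := 𝓘(ℂ)) (n := ω) (x := p)).contMDiffAt
      ((chartAt ℂ p).open_target.mem_nhds hu)
  have h2 : ContMDiffAt 𝓘(ℂ) 𝓘(ℂ) ω (chartAt ℂ q) ((chartAt ℂ p).symm u) :=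
    (contMDiffOn_chart (I := 𝓘(ℂ)) (n := ω) (x := q)).contMDiffAt
      ((chartAt ℂ q).open_source.mem_nhds hq)
  exact (contMDiffAt_iff_contDiffAt.mp (h2.comp u h1)).analyticAt

lemma mdifferentiableAt_chart_symm {p : S} {u : ℂ} (hu : u ∈ (chartAt ℂ p).target) :
    MDifferentiableAt 𝓘(ℂ) 𝓘(ℂ) (chartAt ℂ p).symm u :=
  haveI := isManifold_one_of_omega (S := S)
  mdifferentiableAt_atlas_symm (chart_mem_atlas ℂ p) hu

lemma mdifferentiableAt_chart {p q : S} (hq : q ∈ (chartAt ℂ p).source) :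
    MDifferentiableAt 𝓘(ℂ) 𝓘(ℂ) (chartAt ℂ p) q :=
  haveI := isManifold_one_of_omega (S := S)
  mdifferentiableAt_atlas (chart_mem_atlas ℂ p) hq

/-- Tangent vectors at `q` are complex numbers, by means of the preferred coordinate at `q`; in
this identification `coordVec p` is the derivative of the change of coordinates. -/
lemma coordVec_eq_deriv_transition {p : S} {u : ℂ} (hu : u ∈ (chartAt ℂ p).target) :
    coordVec p u = (deriv (transition p ((chartAt ℂ p).symm u)) u : ℂ) := by
  have h := mdifferentiableAt_chart_symm hu
  simp only [coordVec, mfderiv, h, writtenInExtChartAt]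
  simp [mfld_simps, Function.comp_def]
  rfl

lemma deriv_transition_comp {p q r : S} {u : ℂ} (hu : u ∈ (chartAt ℂ p).target)
    (hq : (chartAt ℂ p).symm u ∈ (chartAt ℂ q).source)
    (hr : (chartAt ℂ p).symm u ∈ (chartAt ℂ r).source) :
    deriv (transition p r) u = deriv (transition q r) (transition p q u) *
      deriv (transition p q) u := by
  have hqt : transition p q u ∈ (chartAt ℂ q).target := (chartAt ℂ q).map_source hq
  have h1 := (analyticAt_transition hu hq).differentiableAt
  have h2 := (analyticAt_transition (p := q) (q := r) hqt
    (by rwa [chartAt_symm_transition hq])).differentiableAt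
  have : transition p r =ᶠ[𝓝 u] transition q r ∘ transition p q := by
    filter_upwards [eventually_symm_mem_source hu hq] with v hv
    simp only [Function.comp, transition, (chartAt ℂ q).left_inv hv]
  rw [this.deriv_eq, deriv_comp u h2 h1]

lemma deriv_transition_ne_zero {p q : S} {u : ℂ} (hu : u ∈ (chartAt ℂ p).target)
    (hq : (chartAt ℂ p).symm u ∈ (chartAt ℂ q).source) :
    deriv (transition p q) u ≠ 0 := by
  intro h0
  have hup : (chartAt ℂ p).symm u ∈ (chartAt ℂ p).source := (chartAt ℂ p).map_target hu
  have h := deriv_transition_comp hu hq hup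
  rw [deriv_transition_self hu, h0, mul_zero] at h
  exact one_ne_zero h

lemma OneForm.coeff_eq_mul (θ : OneForm S) {p : S} {u : ℂ} (hu : u ∈ (chartAt ℂ p).target) :
    θ.coeff p u = deriv (transition p ((chartAt ℂ p).symm u)) u *
      θ ((chartAt ℂ p).symm u) (1 : ℂ) := by
  set a := deriv (transition p ((chartAt ℂ p).symm u)) u with ha
  have h : coordVec p u = a • ((1 : ℂ) : TangentSpace 𝓘(ℂ) ((chartAt ℂ p).symm u)) := by
    rw [coordVec_eq_deriv_transition hu]
    exact (mul_one a).symm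
  rw [OneForm.coeff, h]
  exact (θ ((chartAt ℂ p).symm u)).map_smul a (1 : ℂ)

lemma OneForm.coeff_transition (θ : OneForm S) {p q : S} {u : ℂ}
    (hu : u ∈ (chartAt ℂ p).target) (hq : (chartAt ℂ p).symm u ∈ (chartAt ℂ q).source) :
    θ.coeff p u = deriv (transition p q) u * θ.coeff q (transition p q u) := by
  have hqt : transition p q u ∈ (chartAt ℂ q).target := (chartAt ℂ q).map_source hq
  rw [θ.coeff_eq_mul hu, θ.coeff_eq_mul hqt, chartAt_symm_transition hq,
    deriv_transition_comp hu hq (mem_chart_source ℂ _)]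
  ring

lemma OneForm.analyticAt_coeff (θ : OneForm S) {p : S} {u : ℂ} (hu : u ∈ (chartAt ℂ p).target)
    (h : AnalyticAt ℂ (θ.coeff ((chartAt ℂ p).symm u))
      (chartAt ℂ ((chartAt ℂ p).symm u) ((chartAt ℂ p).symm u))) :
    AnalyticAt ℂ (θ.coeff p) u := by
  set q := (chartAt ℂ p).symm u with hqdef
  have hq : (chartAt ℂ p).symm u ∈ (chartAt ℂ q).source := mem_chart_source ℂ q
  have hψ := analyticAt_transition hu hq
  have h1 : AnalyticAt ℂ (fun v => deriv (transition p q) v * θ.coeff q (transition p q v)) u :=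
    hψ.deriv.mul (AnalyticAt.comp (g := θ.coeff q) h hψ)
  refine h1.congr ?_
  filter_upwards [eventually_mem_target hu, eventually_symm_mem_source hu hq] with v hv hvq
  exact (θ.coeff_transition hv hvq).symm

lemma coeff_d {f : S → ℂ} {p : S} {u : ℂ} (hu : u ∈ (chartAt ℂ p).target)
    (hf : MDifferentiableAt 𝓘(ℂ) 𝓘(ℂ) f ((chartAt ℂ p).symm u)) :
    (d f).coeff p u = deriv (localRep f p) u := by
  have h := mfderiv_comp u hf (mdifferentiableAt_chart_symm hu)
  have h2 : mfderiv 𝓘(ℂ) 𝓘(ℂ) (f ∘ (chartAt ℂ p).symm) u = fderiv ℂ (localRep f p) u :=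
    mfderiv_eq_fderiv
  rw [← fderiv_apply_one_eq_deriv, ← h2, h]
  rfl

lemma mdifferentiableAt_of_localRep {f : S → ℂ} {p : S} {u : ℂ} (hu : u ∈ (chartAt ℂ p).target)
    (hf : DifferentiableAt ℂ (localRep f p) u) :
    MDifferentiableAt 𝓘(ℂ) 𝓘(ℂ) f ((chartAt ℂ p).symm u) := by
  have hs : (chartAt ℂ p).symm u ∈ (chartAt ℂ p).source := (chartAt ℂ p).map_target hu
  have h1 : MDifferentiableAt 𝓘(ℂ) 𝓘(ℂ) (localRep f p) (chartAt ℂ p ((chartAt ℂ p).symm u)) := by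
    rw [(chartAt ℂ p).right_inv hu]
    exact hf.mdifferentiableAt
  refine (h1.comp _ (mdifferentiableAt_chart hs)).congr_of_eventuallyEq ?_
  filter_upwards [(chartAt ℂ p).open_source.mem_nhds hs] with q hq
  simp [localRep, (chartAt ℂ p).left_inv hq]

/-- A Riemann surface is a smooth real surface. -/
lemma isManifold_real : IsManifold 𝓘(ℝ, ℂ) ∞ S := by
  refine isManifold_of_contDiffOn _ _ _ fun e e' he he' => ?_
  have h : ContDiffOn ℂ ω (𝓘(ℂ) ∘ e.symm ≫ₕ e' ∘ 𝓘(ℂ).symm)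
      (𝓘(ℂ).symm ⁻¹' (e.symm ≫ₕ e').source ∩ range 𝓘(ℂ)) :=
    ((contDiffGroupoid ω 𝓘(ℂ)).compatible he he').1
  exact (h.restrict_scalars ℝ).of_le le_top

end Holomorphic

/-! ### The residue theorem -/

/-- A function on `S` in the preferred coordinate at `p`, extended by zero to the plane. -/
noncomputable def chartExt (ρ : S → ℂ) (p : S) : ℂ → ℂ :=
  (chartAt ℂ p).target.indicator (localRep ρ p)

lemma chartExt_eventuallyEq (ρ : S → ℂ) {p : S} {u : ℂ} (hu : u ∈ (chartAt ℂ p).target) :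
    chartExt ρ p =ᶠ[𝓝 u] localRep ρ p := by
  filter_upwards [eventually_mem_target hu] with v hv
  exact indicator_of_mem hv _

lemma notMem_tsupport_localRep {ρ : S → ℂ} {p : S} {u : ℂ} (hu : u ∈ (chartAt ℂ p).target)
    (h : (chartAt ℂ p).symm u ∉ tsupport ρ) : u ∉ tsupport (localRep ρ p) := by
  rw [notMem_tsupport_iff_eventuallyEq]
  exact ((chartAt ℂ p).symm.continuousAt hu).eventually (notMem_tsupport_iff_eventuallyEq.mp h)

/-- The pairing `∫ g · 2∂φ/∂ū · θ` of a differential `θ` with two functions, computed in the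
preferred coordinate at `p`. -/
noncomputable def chartIntegral (θ : OneForm S) (p : S) (g φ : S → ℂ) : ℂ :=
  ∫ u in (chartAt ℂ p).target,
    localRep g p u * (dbar (localRep φ p) u * θ.coeff p u)

section Support

variable [CompactSpace S] {ρ : S → ℂ} {p : S}

lemma tsupport_chartExt_subset (hρ : tsupport ρ ⊆ (chartAt ℂ p).source) :
    tsupport (chartExt ρ p) ⊆ chartAt ℂ p '' tsupport ρ := by
  have hK : IsCompact (chartAt ℂ p '' tsupport ρ) :=
    (isClosed_tsupport ρ).isCompact.image_of_continuousOn ((chartAt ℂ p).continuousOn.mono hρ)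
  refine closure_minimal (fun u hu => ?_) hK.isClosed
  have hut : u ∈ (chartAt ℂ p).target := by
    by_contra h
    exact hu (indicator_of_notMem h _)
  refine ⟨(chartAt ℂ p).symm u, subset_tsupport ρ ?_, (chartAt ℂ p).right_inv hut⟩
  rw [Function.mem_support, chartExt, indicator_of_mem hut] at hu
  exact hu

lemma mem_target_of_mem_tsupport_chartExt (hρ : tsupport ρ ⊆ (chartAt ℂ p).source) {u : ℂ}
    (hu : u ∈ tsupport (chartExt ρ p)) :
    u ∈ (chartAt ℂ p).target ∧ (chartAt ℂ p).symm u ∈ tsupport ρ := by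
  obtain ⟨s, hs, rfl⟩ := tsupport_chartExt_subset hρ hu
  exact ⟨(chartAt ℂ p).map_source (hρ hs), by rwa [(chartAt ℂ p).left_inv (hρ hs)]⟩

lemma hasCompactSupport_chartExt (hρ : tsupport ρ ⊆ (chartAt ℂ p).source) :
    HasCompactSupport (chartExt ρ p) :=
  ((isClosed_tsupport ρ).isCompact.image_of_continuousOn
    ((chartAt ℂ p).continuousOn.mono hρ)).of_isClosed_subset (isClosed_tsupport _)
    (tsupport_chartExt_subset hρ)

end Support

section Holomorphic

variable [IsManifold 𝓘(ℂ) ω S]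

lemma contDiffAt_localRep {ρ : S → ℂ} (hρ : ContMDiff 𝓘(ℝ, ℂ) 𝓘(ℝ, ℂ) 1 ρ) {p : S} {u : ℂ}
    (hu : u ∈ (chartAt ℂ p).target) : ContDiffAt ℝ 1 (localRep ρ p) u := by
  have := isManifold_real (S := S)
  have : IsManifold 𝓘(ℝ, ℂ) 1 S := IsManifold.of_le (n := ∞) (by norm_cast)
  have h1 : ContMDiffAt 𝓘(ℝ, ℂ) 𝓘(ℝ, ℂ) 1 (chartAt ℂ p).symm u :=
    (contMDiffOn_chart_symm (I := 𝓘(ℝ, ℂ)) (n := 1) (x := p)).contMDiffAt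
      ((chartAt ℂ p).open_target.mem_nhds hu)
  exact contMDiffAt_iff_contDiffAt.mp ((hρ _).comp u h1)

lemma continuousAt_dbar_localRep {ρ : S → ℂ} (hρ : ContMDiff 𝓘(ℝ, ℂ) 𝓘(ℝ, ℂ) 1 ρ) {p : S}
    {u : ℂ} (hu : u ∈ (chartAt ℂ p).target) : ContinuousAt (dbar (localRep ρ p)) u := by
  have h : ContinuousAt (fderiv ℝ (localRep ρ p)) u :=
    ((contDiffAt_localRep hρ hu).fderiv_right (m := 0) (by simp)).continuousAt
  unfold dbar
  exact (h.clm_apply continuousAt_const).add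
    (continuousAt_const.mul (h.clm_apply continuousAt_const))

lemma contDiff_chartExt [CompactSpace S] {ρ : S → ℂ}
    (hρ : ContMDiff 𝓘(ℝ, ℂ) 𝓘(ℝ, ℂ) 1 ρ) {p : S}
    (hsupp : tsupport ρ ⊆ (chartAt ℂ p).source) : ContDiff ℝ 1 (chartExt ρ p) := by
  rw [contDiff_iff_contDiffAt]
  intro u
  by_cases hu : u ∈ (chartAt ℂ p).target
  · exact (contDiffAt_localRep hρ hu).congr_of_eventuallyEq (chartExt_eventuallyEq ρ hu)
  · refine (contDiffAt_const (c := (0 : ℂ))).congr_of_eventuallyEq ?_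
    refine notMem_tsupport_iff_eventuallyEq.mp fun h => hu ?_
    exact (mem_target_of_mem_tsupport_chartExt hsupp h).1

/-- The pairing does not depend on the coordinate, as `2∂φ/∂ū · θ` is a `(1,1)`-form. -/
lemma chartIntegral_eq (θ : OneForm S) {p q : S} {g φ : S → ℂ}
    (hφ : ContMDiff 𝓘(ℝ, ℂ) 𝓘(ℝ, ℂ) 1 φ)
    (hp : ∀ s ∈ (chartAt ℂ p).source, s ∉ (chartAt ℂ q).source → g s = 0 ∨ s ∉ tsupport φ)
    (hq : ∀ s ∈ (chartAt ℂ q).source, s ∉ (chartAt ℂ p).source → g s = 0 ∨ s ∉ tsupport φ) :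
    chartIntegral θ p g φ = chartIntegral θ q g φ := by
  have aux (a b : S)
      (h : ∀ s ∈ (chartAt ℂ a).source, s ∉ (chartAt ℂ b).source → g s = 0 ∨ s ∉ tsupport φ) :
      chartIntegral θ a g φ = ∫ u in ((chartAt ℂ a).symm.trans (chartAt ℂ b)).source,
        localRep g a u * (dbar (localRep φ a) u * θ.coeff a u) := by
    have hsub : ((chartAt ℂ a).symm.trans (chartAt ℂ b)).source ⊆ (chartAt ℂ a).target := by
      rw [OpenPartialHomeomorph.trans_source]
      exact inter_subset_left
    refine setIntegral_eq_of_subset_of_forall_sdiff_eq_zero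
      (chartAt ℂ a).open_target.measurableSet hsub fun u hu => ?_
    have hs : (chartAt ℂ a).symm u ∉ (chartAt ℂ b).source := fun hs => by
      apply hu.2
      rw [OpenPartialHomeomorph.trans_source]
      exact ⟨hu.1, hs⟩
    rcases h _ ((chartAt ℂ a).map_target hu.1) hs with h0 | h0
    · simp [localRep, h0]
    · rw [dbar_eq_zero_of_notMem_tsupport (notMem_tsupport_localRep hu.1 h0)]
      simp
  rw [aux p q hp, aux q p hq]
  set T := (chartAt ℂ p).symm.trans (chartAt ℂ q) with hT
  have hsrc (u : ℂ) (hu : u ∈ T.source) :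
      u ∈ (chartAt ℂ p).target ∧ (chartAt ℂ p).symm u ∈ (chartAt ℂ q).source := by
    rwa [hT, OpenPartialHomeomorph.trans_source] at hu
  have himg : ((chartAt ℂ q).symm.trans (chartAt ℂ p)).source = transition p q '' T.source := by
    have h1 : (chartAt ℂ q).symm.trans (chartAt ℂ p) = T.symm := by
      rw [hT, OpenPartialHomeomorph.trans_symm_eq_symm_trans_symm, OpenPartialHomeomorph.symm_symm]
    rw [h1, OpenPartialHomeomorph.symm_source, ← T.image_source_eq_target]
    rfl
  have hder (u : ℂ) (hu : u ∈ T.source) : HasFDerivWithinAt (transition p q)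
      ((fderiv ℂ (transition p q) u).restrictScalars ℝ) T.source u :=
    ((analyticAt_transition (hsrc u hu).1 (hsrc u hu).2).differentiableAt.hasFDerivAt.restrictScalars
      ℝ).hasFDerivWithinAt
  rw [himg, integral_image_eq_integral_abs_det_fderiv_smul volume T.open_source.measurableSet hder
    T.injOn]
  refine setIntegral_congr_fun T.open_source.measurableSet fun u hu => ?_
  obtain ⟨hu1, hu2⟩ := hsrc u hu
  have hqt : transition p q u ∈ (chartAt ℂ q).target := (chartAt ℂ q).map_source hu2
  have hdet : ((fderiv ℂ (transition p q) u).restrictScalars ℝ).det =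
      normSq (deriv (transition p q) u) := by
    rw [← Algebra.norm_complex_apply, ContinuousLinearMap.det,
      show ((fderiv ℂ (transition p q) u).restrictScalars ℝ : ℂ →ₗ[ℝ] ℂ) =
        ((fderiv ℂ (transition p q) u : ℂ →ₗ[ℂ] ℂ) : ℂ →ₗ[ℝ] ℂ) from rfl,
      LinearMap.det_restrictScalars]
    congr 1
    rw [LinearMap.det_ring]
    simp
  have hg : localRep g q (transition p q u) = localRep g p u := by
    simp only [localRep, chartAt_symm_transition hu2]
  have hloc : localRep φ p =ᶠ[𝓝 u] fun v => localRep φ q (transition p q v) := by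
    filter_upwards [eventually_symm_mem_source hu1 hu2] with v hv
    simp only [localRep, chartAt_symm_transition hv]
  have hdb := dbar_comp ((contDiffAt_localRep hφ hqt).differentiableAt one_ne_zero)
    (analyticAt_transition hu1 hu2).differentiableAt
  rw [hdet, hg, dbar_congr hloc, hdb, θ.coeff_transition hu1 hu2, abs_of_nonneg (normSq_nonneg _),
    real_smul, ← mul_conj]
  ring

end Holomorphic

lemma chartIntegral_eq_integral_chartExt_left (θ : OneForm S) (p : S) (g φ : S → ℂ) :
    chartIntegral θ p g φ =
      ∫ u, chartExt g p u * (dbar (localRep φ p) u * θ.coeff p u) := by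
  rw [chartIntegral, ← integral_indicator (chartAt ℂ p).open_target.measurableSet]
  congr 1 with u
  by_cases hu : u ∈ (chartAt ℂ p).target <;> simp [chartExt, hu]

section Compact

variable [CompactSpace S]

lemma chartIntegral_eq_integral_chartExt_right (θ : OneForm S) {p : S} (g : S → ℂ) {φ : S → ℂ}
    (hφ : tsupport φ ⊆ (chartAt ℂ p).source) :
    chartIntegral θ p g φ =
      ∫ u, dbar (chartExt φ p) u * (localRep g p u * θ.coeff p u) := by
  rw [chartIntegral, ← integral_indicator (chartAt ℂ p).open_target.measurableSet]
  congr 1 with u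
  by_cases hu : u ∈ (chartAt ℂ p).target
  · rw [indicator_of_mem hu, dbar_congr (chartExt_eventuallyEq φ hu)]
    ring
  · rw [indicator_of_notMem hu, dbar_eq_zero_of_notMem_tsupport, zero_mul]
    exact fun h => hu (mem_target_of_mem_tsupport_chartExt hφ h).1

variable [IsManifold 𝓘(ℂ) ω S]

lemma chartIntegral_one_eq_zero (θ : OneForm S) {p : S} {φ : S → ℂ}
    (hφ : ContMDiff 𝓘(ℝ, ℂ) 𝓘(ℝ, ℂ) 1 φ) (hsupp : tsupport φ ⊆ (chartAt ℂ p).source)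
    (hθ : ∀ q ∈ tsupport φ, AnalyticAt ℂ (θ.coeff q) (chartAt ℂ q q)) :
    chartIntegral θ p 1 φ = 0 := by
  rw [chartIntegral_eq_integral_chartExt_right θ 1 hsupp]
  simp only [localRep, Pi.one_apply, one_mul]
  refine integral_dbar_mul_eq_zero (contDiff_chartExt hφ hsupp) (hasCompactSupport_chartExt hsupp)
    fun u hu => ?_
  obtain ⟨h1, h2⟩ := mem_target_of_mem_tsupport_chartExt hsupp hu
  exact θ.analyticAt_coeff h1 (hθ _ h2)

/-- The residue at an isolated singularity as a pairing with a cut-off function. -/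
lemma residue_eq_chartIntegral (θ : OneForm S) {p : S} {φ : S → ℂ}
    (hφ : ContMDiff 𝓘(ℝ, ℂ) 𝓘(ℝ, ℂ) 1 φ) (hsupp : tsupport φ ⊆ (chartAt ℂ p).source)
    (hone : ∀ᶠ s in 𝓝 p, φ s = 1)
    (hθ : ∀ q ∈ tsupport φ, q ≠ p → AnalyticAt ℂ (θ.coeff q) (chartAt ℂ q q)) :
    θ.residue p = -(2 * (Real.pi : ℂ))⁻¹ * chartIntegral θ p 1 φ := by
  have hpt := mem_chart_target ℂ p
  have ho : ∀ᶠ u in 𝓝 (chartAt ℂ p p), chartExt φ p u = 1 := by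
    have h1 : Tendsto (chartAt ℂ p).symm (𝓝 (chartAt ℂ p p)) (𝓝 p) := by
      simpa using (chartAt ℂ p).tendsto_symm (mem_chart_source ℂ p)
    filter_upwards [chartExt_eventuallyEq φ hpt, h1.eventually hone] with u hu1 hu2
    rw [hu1, localRep, hu2]
  have key := eventually_integral_dbar_mul_eq_circleIntegral (h := θ.coeff p)
    (contDiff_chartExt hφ hsupp) (hasCompactSupport_chartExt hsupp) ho fun u hu hne => by
      obtain ⟨h1, h2⟩ := mem_target_of_mem_tsupport_chartExt hsupp hu
      refine θ.analyticAt_coeff h1 (hθ _ h2 fun h => hne ?_)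
      exact ((chartAt ℂ p).right_inv h1).symm.trans (congrArg _ h)
  rw [chartIntegral_eq_integral_chartExt_right θ 1 hsupp]
  simp only [localRep, Pi.one_apply, one_mul]
  refine Tendsto.limUnder_eq (tendsto_const_nhds.congr' ?_)
  filter_upwards [key] with r hr
  rw [hr]
  have : (Real.pi : ℂ) ≠ 0 := ofReal_ne_zero.mpr Real.pi_ne_zero
  field_simp
  linear_combination (-∮ u in C(chartAt ℂ p p, r), θ.coeff p u) * I_sq

/-- The residue theorem on a compact Riemann surface, for differentials with finitely many isolated
singularities. -/
theorem sum_residue_eq_zero [T2Space S] (θ : OneForm S) (P : Finset S)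
    (hθ : ∀ q ∉ P, AnalyticAt ℂ (θ.coeff q) (chartAt ℂ q q)) :
    ∑ q ∈ P, θ.residue q = 0 := by
  classical
  have := isManifold_real (S := S)
  -- Each singularity lies in exactly one member of the cover, so the function of the partition of
  -- unity indexed by it is `1` near it.
  set V : S → Set S := fun p => (chartAt ℂ p).source \ (P.erase p : Finset S) with hV
  have hVo (p : S) : IsOpen (V p) :=
    (chartAt ℂ p).open_source.sdiff (P.erase p).finite_toSet.isClosed
  obtain ⟨f, hf⟩ := SmoothPartitionOfUnity.exists_isSubordinate 𝓘(ℝ, ℂ) isClosed_univ V hVo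
    fun p _ => mem_iUnion.mpr ⟨p, mem_chart_source ℂ p, by simp⟩
  set ρ : S → S → ℂ := fun p s => (f p s : ℂ) with hρdef
  have hρ (p : S) : ContMDiff 𝓘(ℝ, ℂ) 𝓘(ℝ, ℂ) 1 (ρ p) := by
    have h1 : ContMDiff 𝓘(ℝ, ℂ) 𝓘(ℝ, ℝ) 1 (f p) := (f p).contMDiff.of_le (by norm_cast)
    exact ofRealCLM.contMDiff.comp h1
  have hsupp (p : S) : tsupport (ρ p) ⊆ V p := by
    refine (closure_mono fun s hs => ?_).trans (hf p)
    simpa [hρdef] using hs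
  have hsrc (p : S) : tsupport (ρ p) ⊆ (chartAt ℂ p).source := (hsupp p).trans sdiff_subset
  have hpole (p q : S) (hq : q ∈ tsupport (ρ p)) (hqp : q ≠ p) : q ∉ P := fun hqP =>
    (hsupp p hq).2 (by simpa using ⟨hqP, hqp⟩)
  have hfin : {p | (Function.support (f p)).Nonempty}.Finite :=
    f.locallyFinite.finite_nonempty_of_compact
  set T := hfin.toFinset with hT
  have hsum (s : S) : ∑ p ∈ T, ρ p s = 1 := by
    have h1 := f.sum_eq_one (mem_univ s)
    rw [finsum_eq_sum_of_support_subset (s := T)] at h1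
    · simp only [hρdef]
      exact_mod_cast h1
    · intro p hp
      simp only [hT, Finite.coe_toFinset]
      exact ⟨s, hp⟩
  have hself (q : S) (hq : q ∈ P) : ∀ᶠ s in 𝓝 q, ρ q s = 1 := by
    have h1 : ∀ᶠ s in 𝓝 q, ∀ p ∈ T.erase q, ρ p s = 0 := by
      rw [Filter.eventually_all_finset]
      intro p hp
      exact notMem_tsupport_iff_eventuallyEq.mp fun h =>
        hpole p q h (Finset.ne_of_mem_erase hp).symm hq
    filter_upwards [h1] with s hs
    have h2 := hsum s
    by_cases hqT : q ∈ T
    · rwa [← Finset.add_sum_erase _ _ hqT, Finset.sum_eq_zero hs, add_zero] at h2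
    · rw [Finset.erase_eq_of_notMem hqT] at hs
      rw [Finset.sum_eq_zero hs] at h2
      exact absurd h2 zero_ne_one
  have hother (p q : S) (hq : q ∈ P) (hpq : q ≠ p) : ∀ᶠ s in 𝓝 q, ρ p s = 0 :=
    notMem_tsupport_iff_eventuallyEq.mp fun h => hpole p q h hpq hq
  have hPT : P ⊆ T := fun q hq => by
    simp only [hT, Finite.mem_toFinset, mem_ofPred_eq]
    refine ⟨q, fun h0 => ?_⟩
    have := (hself q hq).self_of_nhds
    simp [hρdef, h0] at this
  have hconst (p q : S) (hq : q ∈ P) : ∃ a : ℂ, ∀ᶠ s in 𝓝 q, ρ p s = a := by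
    by_cases hpq : q = p
    · exact ⟨1, hpq ▸ hself q hq⟩
    · exact ⟨0, hother p q hq hpq⟩
  -- Each `ρ p` is constant near the singularities, so the integrands vanish there.
  have hint (r p : S) : Integrable fun u =>
      chartExt (ρ r) r u * (dbar (localRep (ρ p) r) u * θ.coeff r u) := by
    refine integrable_mul_of_tsupport (contDiff_chartExt (hρ r) (hsrc r)).continuous
      (hasCompactSupport_chartExt (hsrc r)) fun u hu => ?_
    obtain ⟨hut, -⟩ := mem_target_of_mem_tsupport_chartExt (hsrc r) hu
    by_cases hP : (chartAt ℂ r).symm u ∈ P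
    · obtain ⟨a, ha⟩ := hconst p _ hP
      have h0 : u ∉ tsupport (dbar (localRep (ρ p) r)) :=
        notMem_tsupport_dbar (((chartAt ℂ r).symm.continuousAt hut).eventually ha)
      refine (continuousAt_const (y := (0 : ℂ))).congr ?_
      filter_upwards [notMem_tsupport_iff_eventuallyEq.mp h0] with v hv
      simp [hv]
    · exact (continuousAt_dbar_localRep (hρ p) hut).mul
        (θ.analyticAt_coeff hut (hθ _ hP)).continuousAt
  have hint' (r p : S) : Integrable fun u =>
      dbar (chartExt (ρ p) p) u * (localRep (ρ r) p u * θ.coeff p u) := by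
    refine integrable_mul_of_tsupport (continuous_dbar (contDiff_chartExt (hρ p) (hsrc p)))
      ((hasCompactSupport_chartExt (hsrc p)).mono'
        ((subset_tsupport _).trans (tsupport_dbar_subset _))) fun u hu => ?_
    obtain ⟨hut, -⟩ := mem_target_of_mem_tsupport_chartExt (hsrc p) (tsupport_dbar_subset _ hu)
    have hP : (chartAt ℂ p).symm u ∉ P := fun hP => by
      obtain ⟨a, ha⟩ := hconst p _ hP
      refine notMem_tsupport_dbar (a := a) ?_ hu
      filter_upwards [chartExt_eventuallyEq (ρ p) hut,
        ((chartAt ℂ p).symm.continuousAt hut).eventually ha] with v hv1 hv2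
      rw [hv1]
      exact hv2
    exact (contDiffAt_localRep (hρ r) hut).continuousAt.mul
      (θ.analyticAt_coeff hut (hθ _ hP)).continuousAt
  have hsplit (p : S) : chartIntegral θ p 1 (ρ p) = ∑ r ∈ T, chartIntegral θ p (ρ r) (ρ p) := by
    simp only [chartIntegral_eq_integral_chartExt_right θ _ (hsrc p)]
    rw [← integral_finsetSum _ fun r _ => hint' r p]
    congr 1 with u
    rw [← Finset.mul_sum, ← Finset.sum_mul]
    simp only [localRep, hsum, Pi.one_apply]
  have hchange (p r : S) : chartIntegral θ p (ρ r) (ρ p) = chartIntegral θ r (ρ r) (ρ p) := by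
    refine chartIntegral_eq θ (hρ p) (fun s _ hs => Or.inl ?_) fun s _ hs =>
      Or.inr fun h => hs (hsrc p h)
    exact image_eq_zero_of_notMem_tsupport fun h => hs (hsrc r h)
  have hzero (r : S) : ∑ p ∈ T, chartIntegral θ r (ρ r) (ρ p) = 0 := by
    simp only [chartIntegral_eq_integral_chartExt_left]
    rw [← integral_finsetSum _ fun p _ => hint r p, ← integral_zero ℂ ℂ]
    congr 1 with u
    rw [← Finset.mul_sum, ← Finset.sum_mul]
    by_cases hu : u ∈ (chartAt ℂ r).target
    · rw [← dbar_sum T fun p _ => (contDiffAt_localRep (hρ p) hu).differentiableAt one_ne_zero]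
      simp only [localRep, hsum, dbar_const, zero_mul, mul_zero]
    · simp [chartExt, hu]
  have htotal : ∑ p ∈ T, chartIntegral θ p 1 (ρ p) = 0 := by
    rw [Finset.sum_congr rfl fun p _ => (hsplit p).trans
      (Finset.sum_congr rfl fun r _ => hchange p r), Finset.sum_comm]
    exact Finset.sum_eq_zero fun r _ => hzero r
  have hres : ∑ q ∈ P, θ.residue q =
      ∑ q ∈ P, -(2 * (Real.pi : ℂ))⁻¹ * chartIntegral θ q 1 (ρ q) :=
    Finset.sum_congr rfl fun q hq =>
      residue_eq_chartIntegral θ (hρ q) (hsrc q) (hself q hq) fun s hs hne =>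
        hθ s (hpole q s hs hne)
  rw [hres, ← Finset.mul_sum, Finset.sum_subset hPT fun p _ hp => ?_, htotal, mul_zero]
  refine chartIntegral_one_eq_zero θ (hρ p) (hsrc p) fun q hq => hθ q ?_
  by_cases hqp : q = p
  · rwa [hqp]
  · exact hpole p q hq hqp

end Compact

/-! ### Quotients of meromorphic differentials -/

lemma meromorphicOrderAt_deriv_of_neg {f : ℂ → ℂ} {a : ℂ} {n : ℤ}
    (hf : meromorphicOrderAt f a = n) (hn : n < 0) :
    meromorphicOrderAt (deriv f) a = (n - 1 : ℤ) := by
  have hm : MeromorphicAt f a := by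
    by_contra h
    rw [meromorphicOrderAt_of_not_meromorphicAt h] at hf
    have : (0 : ℤ) = n := by exact_mod_cast hf
    omega
  obtain ⟨g, hg, hg0, hfg⟩ := (meromorphicOrderAt_eq_int_iff hm).mp hf
  refine (meromorphicOrderAt_eq_int_iff hm.deriv).mpr
    ⟨fun z => n * g z + (z - a) * deriv g z, ?_, ?_, ?_⟩
  · exact (analyticAt_const.mul hg).add ((analyticAt_id.sub analyticAt_const).mul hg.deriv)
  · simpa using ⟨hn.ne, hg0⟩
  · have hfg' : f =ᶠ[𝓝[≠] a] fun z => (z - a) ^ n • g z := hfg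
    filter_upwards [hfg'.nhdsNE_deriv, hg.eventually_analyticAt.filter_mono nhdsWithin_le_nhds,
      self_mem_nhdsWithin] with z h1 h2 h3
    have hz : z - a ≠ 0 := sub_ne_zero.mpr h3
    have h4 : HasDerivAt (fun z => (z - a) ^ n) (n * (z - a) ^ (n - 1)) z :=
      (hasDerivAt_zpow n (z - a) (Or.inl hz)).comp_sub_const z a
    have h5 := h4.fun_mul h2.differentiableAt.hasDerivAt
    rw [h1]
    simp only [smul_eq_mul]
    rw [h5.deriv]
    have h6 : (z - a) ^ n = (z - a) ^ (n - 1) * (z - a) := by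
      rw [← zpow_add_one₀ hz, sub_add_cancel]
    rw [h6]
    ring

lemma add_neg_nonneg_of_not_pos {a b : WithTop ℤ} (ha : 0 ≤ a) (hb : ¬ 0 < b) : 0 ≤ a + -b := by
  refine add_nonneg ha ?_
  cases b with
  | top => exact absurd (WithTop.coe_lt_top 0) hb
  | coe b =>
    have h1 : ¬ (0 : ℤ) < b := fun h => hb (by exact_mod_cast h)
    have h2 : (0 : ℤ) ≤ -b := by omega
    exact_mod_cast h2

lemma tendsto_chartAt_nhdsNE {p q : S} (hq : q ∈ (chartAt ℂ p).source) :
    Tendsto (chartAt ℂ p) (𝓝[≠] q) (𝓝[≠] (chartAt ℂ p q)) := by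
  refine tendsto_nhdsWithin_iff.mpr
    ⟨((chartAt ℂ p).continuousAt hq).tendsto.mono_left nhdsWithin_le_nhds, ?_⟩
  filter_upwards [self_mem_nhdsWithin, mem_nhdsWithin_of_mem_nhds
    ((chartAt ℂ p).open_source.mem_nhds hq)] with s hs hs'
  exact fun h => hs ((chartAt ℂ p).injOn hs' hq h)

lemma tendsto_chartAt_symm_nhdsNE {p : S} {u : ℂ} (hu : u ∈ (chartAt ℂ p).target) :
    Tendsto (chartAt ℂ p).symm (𝓝[≠] u) (𝓝[≠] ((chartAt ℂ p).symm u)) := by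
  refine tendsto_nhdsWithin_iff.mpr
    ⟨((chartAt ℂ p).symm.continuousAt hu).tendsto.mono_left nhdsWithin_le_nhds, ?_⟩
  filter_upwards [self_mem_nhdsWithin, mem_nhdsWithin_of_mem_nhds (eventually_mem_target hu)]
    with v hv hv'
  exact fun h => hv ((chartAt ℂ p).symm.injOn hv' hu h)

lemma nhdsNE_neBot (p : S) : (𝓝[≠] p).NeBot := by
  have h := tendsto_chartAt_symm_nhdsNE (mem_chart_target ℂ p)
  rw [(chartAt ℂ p).left_inv (mem_chart_source ℂ p)] at h
  exact h.neBot

lemma chartAt_symm_self (p : S) : (chartAt ℂ p).symm (chartAt ℂ p p) = p :=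
  (chartAt ℂ p).left_inv (mem_chart_source ℂ p)

lemma OneForm.ord_congr {θ τ : OneForm S} {p : S} (h : ∀ᶠ q in 𝓝[≠] p, θ q = τ q) :
    θ.ord p = τ.ord p := by
  have h1 := tendsto_chartAt_symm_nhdsNE (mem_chart_target ℂ p)
  rw [chartAt_symm_self] at h1
  refine meromorphicOrderAt_congr ?_
  filter_upwards [h1.eventually h] with u hu
  simp only [OneForm.coeff, hu]

section Holomorphic

variable [IsManifold 𝓘(ℂ) ω S]

/-- The quotient of two differentials in the preferred coordinate at `p`, as a function in the
plane whose removable singularities need not be filled in. -/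
noncomputable def coeffRatio (θ τ : OneForm S) (p : S) (u : ℂ) : ℂ :=
  θ.coeff p u / τ.coeff p u

lemma quotient_eq_of_tendsto (θ τ : OneForm S) {p q : S} (hq : q ∈ (chartAt ℂ p).source) {a : ℂ}
    (h : Tendsto (coeffRatio θ τ p) (𝓝[≠] (chartAt ℂ p q)) (𝓝 a)) :
    θ.quotient τ q = a := by
  have := nhdsNE_neBot q
  refine Tendsto.limUnder_eq ((h.comp (tendsto_chartAt_nhdsNE hq)).congr' ?_)
  filter_upwards [mem_nhdsWithin_of_mem_nhds ((chartAt ℂ p).open_source.mem_nhds hq)] with s hs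
  have hu : chartAt ℂ p s ∈ (chartAt ℂ p).target := (chartAt ℂ p).map_source hs
  have hne : deriv (transition p ((chartAt ℂ p).symm (chartAt ℂ p s))) (chartAt ℂ p s) ≠ 0 :=
    deriv_transition_ne_zero hu (mem_chart_source ℂ _)
  simp only [Function.comp, coeffRatio]
  rw [θ.coeff_eq_mul hu, τ.coeff_eq_mul hu, mul_div_mul_left _ _ hne, (chartAt ℂ p).left_inv hs]

lemma localRep_quotient_eventuallyEq {θ τ : OneForm S} (hθ : θ.IsMeromorphic)
    (hτ : τ.IsMeromorphic) (p : S) :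
    localRep (θ.quotient τ) p =ᶠ[𝓝[≠] (chartAt ℂ p p)] coeffRatio θ τ p := by
  have hm : MeromorphicAt (coeffRatio θ τ p) (chartAt ℂ p p) := (hθ p).div (hτ p)
  filter_upwards [hm.eventually_analyticAt, mem_nhdsWithin_of_mem_nhds
    (eventually_mem_target (mem_chart_target ℂ p))] with u hu hut
  refine quotient_eq_of_tendsto θ τ ((chartAt ℂ p).map_target hut) ?_
  rw [(chartAt ℂ p).right_inv hut]
  exact hu.continuousAt.tendsto.mono_left nhdsWithin_le_nhds

lemma ordAt_quotient {θ τ : OneForm S} (hθ : θ.IsMeromorphic) (hτ : τ.IsMeromorphic) (p : S) :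
    ordAt (θ.quotient τ) p = θ.ord p + -τ.ord p := by
  rw [ordAt, meromorphicOrderAt_congr (localRep_quotient_eventuallyEq hθ hτ p)]
  have : coeffRatio θ τ p = θ.coeff p * (τ.coeff p)⁻¹ := by
    ext u
    simp [coeffRatio, div_eq_mul_inv]
  rw [this, meromorphicOrderAt_mul (hθ p) (hτ p).inv, meromorphicOrderAt_inv]
  rfl

/-- Removable singularities of a quotient are filled in. -/
lemma analyticAt_localRep_quotient {θ τ : OneForm S} (hθ : θ.IsMeromorphic)
    (hτ : τ.IsMeromorphic) {p : S} (h : 0 ≤ ordAt (θ.quotient τ) p) :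
    AnalyticAt ℂ (localRep (θ.quotient τ) p) (chartAt ℂ p p) := by
  have he := localRep_quotient_eventuallyEq hθ hτ p
  have hm : MeromorphicAt (coeffRatio θ τ p) (chartAt ℂ p p) := (hθ p).div (hτ p)
  rw [ordAt, meromorphicOrderAt_congr he] at h
  obtain ⟨a, ha⟩ := tendsto_nhds_of_meromorphicOrderAt_nonneg hm h
  refine (hm.congr he.symm).analyticAt ?_
  rw [continuousAt_iff_punctured_nhds, localRep, chartAt_symm_self,
    quotient_eq_of_tendsto θ τ (mem_chart_source ℂ p) ha]
  exact ha.congr' he.symm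

lemma coeff_d_eventuallyEq {f : S → ℂ} {p : S}
    (hf : ∀ᶠ q in 𝓝[≠] p, MDifferentiableAt 𝓘(ℂ) 𝓘(ℂ) f q) :
    (d f).coeff p =ᶠ[𝓝[≠] (chartAt ℂ p p)] deriv (localRep f p) := by
  have h := tendsto_chartAt_symm_nhdsNE (mem_chart_target ℂ p)
  rw [chartAt_symm_self] at h
  filter_upwards [h.eventually hf, mem_nhdsWithin_of_mem_nhds
    (eventually_mem_target (mem_chart_target ℂ p))] with u hu hut
  exact coeff_d hut hu

lemma eventually_mdifferentiableAt {f : S → ℂ} {p : S}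
    (hf : MeromorphicAt (localRep f p) (chartAt ℂ p p)) :
    ∀ᶠ q in 𝓝[≠] p, MDifferentiableAt 𝓘(ℂ) 𝓘(ℂ) f q := by
  filter_upwards [(tendsto_chartAt_nhdsNE (mem_chart_source ℂ p)).eventually
    hf.eventually_analyticAt, mem_nhdsWithin_of_mem_nhds
    ((chartAt ℂ p).open_source.mem_nhds (mem_chart_source ℂ p))] with q hq hqs
  have := mdifferentiableAt_of_localRep ((chartAt ℂ p).map_source hqs) hq.differentiableAt
  rwa [(chartAt ℂ p).left_inv hqs] at this

lemma IsMeromorphicFun.d_isMeromorphic {f : S → ℂ} (hf : IsMeromorphicFun f) :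
    (d f).IsMeromorphic := fun p =>
  (hf p).meromorphicAt.deriv.congr
    (coeff_d_eventuallyEq (eventually_mdifferentiableAt (hf p).meromorphicAt)).symm

lemma ord_d {f : S → ℂ} {p : S} (hf : ∀ᶠ q in 𝓝[≠] p, MDifferentiableAt 𝓘(ℂ) 𝓘(ℂ) f q) :
    (d f).ord p = meromorphicOrderAt (deriv (localRep f p)) (chartAt ℂ p p) :=
  meromorphicOrderAt_congr (coeff_d_eventuallyEq hf)

/-- At a pole of the global coordinate `y`, the differential `dy` has a double pole, and the pole
of `dx` at a pole of `x` is at least double. -/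
lemma ordAt_quotient_nonneg_of_isGlobalCoordinate [T2Space S] {x : S → ℂ}
    (hx : IsMeromorphicFun x) {dy : OneForm S} (hdy : dy.IsMeromorphic) {y : S → ℂ} {pinf : S}
    (hy : IsGlobalCoordinate y pinf) (hdyy : ∀ p, p ≠ pinf → dy p = d y p)
    (hxinf : ordAt x pinf < 0) {p : S} (hp : ¬ 0 < (d x).ord p) :
    0 ≤ ordAt (dy.quotient (d x)) p := by
  have hdx := hx.d_isMeromorphic
  have hne : ∀ᶠ q in 𝓝[≠] p, q ≠ pinf := by
    by_cases h : p = pinf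
    · rw [h]
      exact self_mem_nhdsWithin
    · exact mem_nhdsWithin_of_mem_nhds (isOpen_ne.mem_nhds h)
  have hdiff : ∀ᶠ q in 𝓝[≠] p, MDifferentiableAt 𝓘(ℂ) 𝓘(ℂ) y q :=
    hne.mono fun q hq => hy.holomorphic q hq
  have hord : dy.ord p = meromorphicOrderAt (deriv (localRep y p)) (chartAt ℂ p p) := by
    rw [OneForm.ord_congr (hne.mono fun q hq => hdyy q hq), ord_d hdiff]
  rw [ordAt_quotient hdy hdx]
  by_cases h : p = pinf
  · subst h
    have h1 : dy.ord p = ((-2 : ℤ) : WithTop ℤ) :=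
      hord.trans (meromorphicOrderAt_deriv_of_neg (n := -1) hy.simple_pole (by norm_num))
    obtain ⟨k, hk⟩ := WithTop.ne_top_iff_exists.mp hxinf.ne_top
    have hk0 : k < 0 := by
      rw [← hk] at hxinf
      exact_mod_cast hxinf
    have h2 : (d x).ord p = ((k - 1 : ℤ) : WithTop ℤ) := by
      rw [ord_d (eventually_mdifferentiableAt (hx p).meromorphicAt)]
      exact meromorphicOrderAt_deriv_of_neg hk.symm hk0
    rw [h1, h2]
    have : (0 : ℤ) ≤ -2 + -(k - 1) := by omega
    exact_mod_cast this
  · have han : AnalyticAt ℂ (localRep y p) (chartAt ℂ p p) := by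
      refine DifferentiableOn.analyticAt (s := (chartAt ℂ p).target ∩
        (chartAt ℂ p).symm ⁻¹' {pinf}ᶜ) (fun u hu => ?_) ?_
      · have := (hy.holomorphic _ hu.2).comp u (mdifferentiableAt_chart_symm hu.1)
        exact (mdifferentiableAt_iff_differentiableAt.mp this).differentiableWithinAt
      · refine Filter.inter_mem (eventually_mem_target (mem_chart_target ℂ p)) ?_
        refine ((chartAt ℂ p).symm.continuousAt (mem_chart_target ℂ p)).preimage_mem_nhds ?_
        rw [chartAt_symm_self]
        exact isOpen_ne.mem_nhds h
    exact add_neg_nonneg_of_not_pos (hord ▸ han.deriv.meromorphicOrderAt_nonneg) hp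

end Holomorphic

/-! ### The vanishing of `η` -/

/-- Cauchy's formula for the derivative, as the residue at a double pole. -/
lemma OneForm.residue_eq_deriv (θ : OneForm S) {p : S} {H : ℂ → ℂ}
    (hH : AnalyticAt ℂ H (chartAt ℂ p p))
    (h : θ.coeff p =ᶠ[𝓝[≠] (chartAt ℂ p p)] fun u => ((u - chartAt ℂ p p) ^ 2)⁻¹ * H u) :
    θ.residue p = deriv H (chartAt ℂ p p) := by
  refine Tendsto.limUnder_eq (tendsto_const_nhds.congr' ?_)
  obtain ⟨R, hR, hball⟩ := nhds_basis_closedBall.eventually_iff.mp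
    (hH.eventually_analyticAt.and (eventually_nhdsWithin_iff.mp h))
  filter_upwards [Ioo_mem_nhdsGT hR] with r hr
  have hsub : closedBall (chartAt ℂ p p) r ⊆ ball (chartAt ℂ p p) R :=
    closedBall_subset_ball hr.2
  have hd : DifferentiableOn ℂ H (ball (chartAt ℂ p p) R) := fun u hu =>
    (hball (ball_subset_closedBall hu)).1.differentiableAt.differentiableWithinAt
  rw [← two_pi_I_inv_smul_circleIntegral_sub_sq_inv_smul_of_differentiable isOpen_ball hsub hd
    (mem_ball_self hr.1), smul_eq_mul]
  congr 1
  refine circleIntegral.integral_congr hr.1.le fun u hu => ?_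
  have hne : u ≠ chartAt ℂ p p := by
    rintro rfl
    simp [hr.1.ne] at hu
  exact ((hball (ball_subset_closedBall (hsub (sphere_subset_closedBall hu)))).2 hne).symm

section Holomorphic

variable [IsManifold 𝓘(ℂ) ω S]

lemma OneForm.apply_eq_mul_coeff (θ : OneForm S) (p : S) (v : TangentSpace 𝓘(ℂ) p) :
    θ p v = (show ℂ from v) * θ.coeff p (chartAt ℂ p p) := by
  have h1 : θ.coeff p (chartAt ℂ p p) = θ p (1 : ℂ) := by
    rw [θ.coeff_eq_mul (mem_chart_target ℂ p), chartAt_symm_self,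
      deriv_transition_self (mem_chart_target ℂ p), one_mul]
  have h2 : θ p ((show ℂ from v) • (1 : ℂ) : ℂ) = (show ℂ from v) • θ p (1 : ℂ) :=
    (θ p).map_smul (show ℂ from v) (1 : ℂ)
  rw [h1, ← smul_eq_mul, ← h2, smul_eq_mul, mul_one]

lemma coeff_contract (B : Bidifferential S) (z : S) (v : TangentSpace 𝓘(ℂ) z) (q : S) (u : ℂ) :
    (B.contract z v).coeff q u = (show ℂ from v) * B.coeff z q (chartAt ℂ z z, u) := by
  have h1 : coordVec z (chartAt ℂ z z) = (1 : ℂ) := by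
    have h : deriv (transition z ((chartAt ℂ z).symm (chartAt ℂ z z))) (chartAt ℂ z z) = 1 := by
      rw [chartAt_symm_self, deriv_transition_self (mem_chart_target ℂ z)]
    exact (coordVec_eq_deriv_transition (mem_chart_target ℂ z)).trans h
  have h2 (s : S) (hs : s = z) : B s ((chartAt ℂ q).symm u) (1 : ℂ) (coordVec q u) =
      B z ((chartAt ℂ q).symm u) (1 : ℂ) (coordVec q u) := by
    subst hs
    rfl
  have h3 : B z ((chartAt ℂ q).symm u) ((show ℂ from v) • (1 : ℂ) : ℂ) =
      (show ℂ from v) • B z ((chartAt ℂ q).symm u) (1 : ℂ) :=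
    (B z ((chartAt ℂ q).symm u)).map_smul (show ℂ from v) (1 : ℂ)
  rw [smul_eq_mul, mul_one] at h3
  simp only [Bidifferential.coeff, h1]
  rw [h2 _ (chartAt_symm_self z)]
  exact congrArg (fun L => L (coordVec q u)) h3

/-- The residue at `z` of `f(z') B(z, z')` is `df(z)`. -/
lemma residue_smul_contract {B : Bidifferential S} (hB : B.IsCanonical) {f : S → ℂ} {z : S}
    (hf : AnalyticAt ℂ (localRep f z) (chartAt ℂ z z)) (v : TangentSpace 𝓘(ℂ) z) :
    OneForm.residue (fun z' => f z' • B.contract z v z') z = d f z v := by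
  set u₀ := chartAt ℂ z z with hu₀
  obtain ⟨g, hg, hBg⟩ := hB.double_pole z
  have hd : d f z v = (show ℂ from v) * deriv (localRep f z) u₀ := by
    rw [(d f).apply_eq_mul_coeff z v, coeff_d (mem_chart_target ℂ z)]
    exact mdifferentiableAt_of_localRep (mem_chart_target ℂ z) hf.differentiableAt
  have hg1 : AnalyticAt ℂ (fun u => g (u₀, u)) u₀ :=
    AnalyticAt.comp (g := g) hg (analyticAt_const.prod analyticAt_id)
  have hK : AnalyticAt ℂ (fun u => 1 + (u - u₀) ^ 2 * g (u₀, u)) u₀ :=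
    analyticAt_const.add (((analyticAt_id.sub analyticAt_const).pow 2).mul hg1)
  have hKd : HasDerivAt (fun u => 1 + (u - u₀) ^ 2 * g (u₀, u)) 0 u₀ := by
    have h1 : HasDerivAt (fun u => (u - u₀) ^ 2) (2 * (u₀ - u₀)) u₀ := by
      simpa using ((hasDerivAt_id u₀).sub_const u₀).fun_pow 2
    simpa using (h1.fun_mul hg1.differentiableAt.hasDerivAt).const_add 1
  rw [hd, OneForm.residue_eq_deriv (p := z)
    (H := fun u => (show ℂ from v) * (localRep f z u * (1 + (u - u₀) ^ 2 * g (u₀, u))))]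
  · have := (hf.differentiableAt.hasDerivAt.fun_mul hKd).const_mul (show ℂ from v)
    rw [this.deriv]
    simp
  · exact analyticAt_const.mul (hf.mul hK)
  · have hB1 : ∀ᶠ u in 𝓝 u₀, u₀ ≠ u → B.coeff z z (u₀, u) = 1 / (u₀ - u) ^ 2 + g (u₀, u) :=
      ((continuous_const.prodMk continuous_id).tendsto' u₀ (u₀, u₀) rfl).eventually hBg
    filter_upwards [mem_nhdsWithin_of_mem_nhds hB1, self_mem_nhdsWithin] with u hu hne
    have h0 : u - u₀ ≠ 0 := sub_ne_zero.mpr hne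
    have h1 : OneForm.coeff (fun z' => f z' • B.contract z v z') z u =
        localRep f z u * (B.contract z v).coeff z u := rfl
    rw [h1, coeff_contract, hu (Ne.symm hne), ← neg_sub u u₀, neg_sq, ← hu₀]
    field_simp

/-- The residue theorem for `f(z') B(z, z')`, when `f` is holomorphic off the `c i`. -/
lemma d_add_sum_residue_eq_zero [T2Space S] [CompactSpace S] {B : Bidifferential S}
    (hB : B.IsCanonical) {f : S → ℂ} {n : ℕ} {c : Fin n → S} (hc : Function.Injective c)
    (hf : ∀ p, p ∉ range c → AnalyticAt ℂ (localRep f p) (chartAt ℂ p p)) {z : S}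
    (hz : z ∉ range c) (v : TangentSpace 𝓘(ℂ) z) :
    d f z v + ∑ i, OneForm.residue (fun z' => f z' • B.contract z v z') (c i) = 0 := by
  classical
  have hzP : z ∉ Finset.univ.image c := by simpa using hz
  have key := sum_residue_eq_zero (fun z' => f z' • B.contract z v z')
    (insert z (Finset.univ.image c)) fun q hq => by
      have hq' : q ≠ z ∧ q ∉ range c := by simpa using hq
      have hB1 : AnalyticAt ℂ (fun u => B.coeff z q (chartAt ℂ z z, u)) (chartAt ℂ q q) :=
        AnalyticAt.comp (g := B.coeff z q) (hB.holomorphic_off_diag z q hq'.1.symm)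
          (analyticAt_const.prod analyticAt_id)
      refine ((hf q hq'.2).mul (analyticAt_const (v := (show ℂ from v)) |>.mul hB1)).congr
        (Eventually.of_forall fun u => ?_)
      exact congrArg (localRep f q u * ·) (coeff_contract B z v q u).symm
  rwa [Finset.sum_insert hzP, Finset.sum_image hc.injOn,
    residue_smul_contract hB (hf z hz) v] at key

end Holomorphic

/-! ### Consequences of the vanishing -/

lemma invariantAt_of_forall_eq_zero [T2Space S] {x : S → ℂ}
    {η : ∀ p : S, TangentSpace 𝓘(ℂ) p → ℂ} {P : Set S} (hP : P.Finite)
    (hη : ∀ p ∉ P, ∀ v, η p v = 0) (a : S) : InvariantAt x a η := by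
  intro σ hσ
  have hP' : IsClosed (P \ {a}) := (hP.subset sdiff_subset).isClosed
  have h1 : ∀ᶠ p in 𝓝 a, p ∉ P \ {a} := hP'.isOpen_compl.mem_nhds (by simp)
  have hcont : Tendsto σ (𝓝 a) (𝓝 a) := by
    simpa [ContinuousAt, hσ.fixed] using hσ.holomorphic.self_of_nhds.continuousAt
  filter_upwards [mem_nhdsWithin_of_mem_nhds h1, mem_nhdsWithin_of_mem_nhds (hcont.eventually h1),
    mem_nhdsWithin_of_mem_nhds hσ.involutive, self_mem_nhdsWithin] with p hp hσp hinv hne v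
  have hσne : σ p ≠ a := fun h => hne (by rw [mem_singleton_iff, ← hinv, h, hσ.fixed])
  rw [hη p fun h => hp ⟨h, hne⟩, hη (σ p) fun h => hσp ⟨h, hσne⟩]

/-- A curve along which `x = x(a) - w² / 2` meets a finite set for finitely many `w` only. -/
lemma laplaceVanishesAt_of_forall_eq_zero {x : S → ℂ}
    {η : ∀ p : S, TangentSpace 𝓘(ℂ) p → ℂ} {P : Set S} (hP : P.Finite)
    (hη : ∀ p ∉ P, ∀ v, η p v = 0) (a : S) : LaplaceVanishesAt x a η := by
  intro I γ hI _ _ _ _ _ hxγ ζ _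
  have hfin : {w : ℝ | w ∈ I ∧ γ w ∈ P}.Finite := by
    have hsq (q : S) : {w : ℝ | (w : ℂ) ^ 2 = 2 * (x a - x q)}.Finite := by
      by_cases h : ∃ w₀ : ℝ, (w₀ : ℂ) ^ 2 = 2 * (x a - x q)
      · obtain ⟨w₀, hw₀⟩ := h
        refine (toFinite {w₀, -w₀}).subset fun w hw => ?_
        have h2 : (w : ℂ) ^ 2 = (w₀ : ℂ) ^ 2 := hw.trans hw₀.symm
        exact sq_eq_sq_iff_eq_or_eq_neg.mp (by exact_mod_cast h2)
      · exact Set.finite_empty.subset fun w hw => h ⟨w, hw⟩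
    refine (hP.biUnion fun q _ => hsq q).subset fun w hw => mem_biUnion hw.2 ?_
    change (w : ℂ) ^ 2 = 2 * (x a - x (γ w))
    rw [hxγ w hw.1]
    ring
  have hae : (fun w : ℝ => η (γ w) (velocity γ w) * Complex.exp ((x (γ w) - x a) * ζ))
      =ᵐ[volume.restrict I] fun _ => 0 := by
    rw [EventuallyEq, ae_restrict_iff' hI.measurableSet]
    filter_upwards [hfin.countable.ae_notMem volume] with w hw hwI
    rw [hη (γ w) fun h => hw ⟨hwI, h⟩, zero_mul]
  refine ⟨(integrable_zero ℝ ℂ _).congr hae.symm, ?_⟩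
  rw [integral_congr_ae hae, integral_zero]

end SpectralCurve

theorem mainTheorem6 {S : Type*} [TopologicalSpace S] [T2Space S] [CompactSpace S]
    [ConnectedSpace S] [ChartedSpace ℂ S] [IsManifold 𝓘(ℂ) ω S]
    (x : S → ℂ) (hx : IsMeromorphicFun x)
    (dy : OneForm S) (hdy : dy.IsMeromorphic)
    {n : ℕ} (c : Fin n → S) (hc : Function.Injective c)
    (hcrit : ∀ p : S, p ∈ Set.range c ↔ 0 < (d x).ord p)
    (B : Bidifferential S) (hB : B.IsCanonical)
    {ι : Type*} (α : ι → ℝ → S) (hα : ∀ i, IsClosedCurve (α i))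
    (hnorm : ∀ i, B.IsNormalizedOn (α i))
    (h : (∃ (y : S → ℂ) (pinf : S), IsGlobalCoordinate y pinf ∧
            (∀ p, p ≠ pinf → dy p = d y p) ∧ ordAt x pinf < 0) ∨
          (∀ p : S, ordAt (dy.quotient (d x)) p < 0 → 0 < (d x).ord p) ∨
          (∀ p : S, 0 ≤ dy.ord p)) :
    (∀ p : S, p ∉ Set.range c → ∀ v : TangentSpace 𝓘(ℂ) p, eta x dy B c p v = 0) ∧
      (∀ i, InvariantAt x (c i) (eta x dy B c)) ∧
      (∀ i, LaplaceVanishesAt x (c i) (eta x dy B c)) := by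
  have hdx := hx.d_isMeromorphic
  have hord (p : S) (hp : p ∉ Set.range c) : 0 ≤ ordAt (dy.quotient (d x)) p := by
    rw [hcrit] at hp
    rcases h with ⟨y, pinf, hy, hdyy, hxinf⟩ | h | h
    · exact ordAt_quotient_nonneg_of_isGlobalCoordinate hx hdy hy hdyy hxinf hp
    · exact not_lt.mp fun h0 => hp (h p h0)
    · rw [ordAt_quotient hdy hdx]
      exact add_neg_nonneg_of_not_pos (h p) hp
  have hη (p : S) (hp : p ∉ Set.range c) (v : TangentSpace 𝓘(ℂ) p) : eta x dy B c p v = 0 :=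
    d_add_sum_residue_eq_zero hB hc
      (fun q hq => analyticAt_localRep_quotient hdy hdx (hord q hq)) hp v
  exact ⟨hη, fun i => invariantAt_of_forall_eq_zero (Set.finite_range c) hη (c i),
    fun i => laplaceVanishesAt_of_forall_eq_zero (Set.finite_range c) hη (c i)⟩
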